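/- **Simon's problem.** For $N>0$ draw a uniform $s\in\{0,1\}^N\setminus\{0\}$, a uniform bit $b$, and a function $f:\{0,1\}^N\to\{0,1\}^N$ that is a uniformly random 1-to-1 function if $b=0$, and a uniformly random function with $f(x)=f(y)\iff y\in\{x,x\oplus s\}$ if $b=1$. The task is to output $a\in\{0,1\}$ with $a=b$ with probability at least $2/3$ on average over $s,b,f$ and the algorithm's randomness. **Framework.** A classical computer has $W$ bits, initially all $0$, and energies that are a sum of one-bit energies. The agent applies reversible logic operations $U_1,\dots,U_{M+1}$ (permutations of $\{0,1\}^W$, drawn from an arbitrary joint probability distribution). Between $U_k$ and $U_{k+1}$ a query of $f$ is made, $|x,0\rangle\mapsto|x,f(x)\rangle$ on $2N$ designated bits; whether it is made may depend on the memory outside the answer register. The oracle may only be called with answer register $0$. Finally one designated bit is swapped with an output register that was prepared in $0$, which yields the output $a$; let $\rho_a^C$ be the state of the memory given $a$, and $S(C|a)=\sum_a p(a)S(\rho_a^C)$ with $S(\rho)=-\mathrm{tr}\,\rho\ln\rho$. The memory is then reinitialized by a unitary (which may depend on $a$) on the memory and a finite-dimensional bath with Hamiltonian $H_E$, initially in the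 Gibbs state at inverse temperature $\beta>0$; the infidelity is the largest $1-\langle 0|\rho'_w|0\rangle$ over the reduced states $\rho'_w$ of the single bits afterwards. The energy consumption is $\mathcal W=\mathcal W_{\rm gates}+\Delta E^{(\rm in)}-\Delta E^{(\rm out)}$, averaged over all randomness. Here $\mathcal W_{\rm gates}$ is the sum of the energy changes of the memory under the $U_k$ and under the erasure, of arbitrary nonnegative control costs of the $U_k$, of the swaps and of the erasure, and of the heat $\mathcal Q_E=\mathrm{tr}[H_E(\rho'_E-\rho_E)]$; $\Delta E^{(\rm in)}$ is the energy that the oracle calls transfer into the memory, and $\Delta E^{(\rm out)}$ is the energy transferred to the output register. **Statement.** Let $N>0$ and let a probabilistic, adaptive classical algorithm in this framework solve Simon's problem with success probability at least $2/3$. 1. In the limit of closing the thermodynamic cycle, $\mathcal W\ge\frac1\beta S(C|a)$: for all bit energies and every $\delta>0$ there is $\varepsilon>0$ such that $\mathcal W\ge\frac1\beta S(C|a)-\delta$ for all control costs and all reinitializations with infidelity at most $\varepsilon$. 2. For every $\Delta\in(0,1/6)$, $$S(C|a)\ \ge\ \frac{1-6\Delta}{6-12\Delta}\left(\sqrt{\frac{2\Delta}{1+\Delta}}\;2^{N/2}(N\ln2-1)-1\right)-\ln2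 .$$ The constant factor $\frac{1-6\Delta}{6-12\Delta}\sqrt{\frac{2\Delta}{1+\Delta}}$ of the leading order attains its maximum over $(0,1/6)$ at $\Delta=2-\frac{\sqrt{15}}2\in(0,1/6)$, for which the bound reads $$S(C|a)\ \ge\ \frac{3\sqrt{15}-11}{6\sqrt{15}-18}\left(\sqrt{\frac{8-2\sqrt{15}}{6-\sqrt{15}}}\;2^{N/2}(N\ln2-1)-1\right)-\ln2 .$$ 3. Consequently there are absolute constants $c>0$ and $N_0$ such that $S(C|a)\ge c\,N\,2^{N/2}$ for all such algorithms with $N\ge N_0$. For every fixed $\beta>0$ the energy consumption is at least $e^{\Omega(N+\log N)}$: there are $c>0$ and $N_0$, depending only on $\beta$, such that for all such algorithms with $N\ge N_0$ and all bit energies there is $\varepsilon>0$ such that $\mathcal W\ge e^{c(N+\log N)}$ for all control costs and all reinitializations with infidelity at most $\varepsilon$. -/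

import Mathlib

open scoped Kronecker NNReal

noncomputable section

namespace SimonThermo

/-! ### Simon's problem -/

/-- Bit strings of length `n`. The bit `0` is `false`, the bit `1` is `true`. -/
abbrev Bits (n : ℕ) : Type := Fin n → Bool

/-- Bitwise exclusive or. -/
def bxor {n : ℕ} (x y : Bits n) : Bits n := fun i => xor (x i) (y i)

/-- The all-zero string. -/
def zeroBits (n : ℕ) : Bits n := fun _ => false

/-- The functions that are possible for given `b` and `s`: for `b = 0` the 1-to-1 functions, for
`b = 1` the 2-to-1 functions whose only collisions are those between `x` and `x ⊕ s`. -/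
def IsSimonFunction {N : ℕ} (b : Bool) (s : Bits N) (f : Bits N → Bits N) : Prop :=
  match b with
  | false => Function.Injective f
  | true => ∀ x y, f x = f y ↔ y = x ∨ y = bxor x s

open Classical in
/-- The probability of the triple `(s, b, f)`: `b` is a fair bit, `s` is a uniform nonzero string,
and `f` is uniform among the functions that are possible for `b` and `s`. -/
def simonWeight {N : ℕ} (b : Bool) (s : Bits N) (f : Bits N → Bits N) : ℝ :=
  if s ≠ zeroBits N ∧ IsSimonFunction b s f then
    (1 / 2) * (1 / ((2 : ℝ) ^ N - 1)) *
      (1 / (Fintype.card {g : Bits N → Bits N // IsSimonFunction b s g} : ℝ))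
  else 0

/-! ### Classical query algorithms -/

/-- A sequence `U₁, …, U_{M+1}` of reversible logic operations on `W` bits. -/
abbrev GateSequence (W M : ℕ) : Type := Fin (M + 1) → Equiv.Perm (Bits W)

/-- A probabilistic, adaptive classical algorithm with an oracle for functions on `N` bits: a
computer with `width` bits, at most `queries` oracle calls, the bits that are exchanged with the
oracle (`inp` holds `x`, and `ans` holds `0` before the call and `f x` after it), the bit that is
swapped into the output register, and a probability distribution over the sequences of reversible
operations that are performed between the calls. `active k z` says whether the `k`-th call is
performed when the memory is `z` (so the number of calls is itself adaptive); the decision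
is read off the bits outside the answer register. -/
structure ClassicalAlgorithm (N : ℕ) where
  width : ℕ
  queries : ℕ
  inp : Fin N ↪ Fin width
  ans : Fin N ↪ Fin width
  inp_ne_ans : ∀ i j, inp i ≠ ans j
  out : Fin width
  active : Fin queries → Bits width → Bool
  active_congr : ∀ k z z', (∀ w, w ∉ Set.range ans → z w = z' w) → active k z = active k z'
  weight : GateSequence width queries → ℝ
  weight_nonneg : ∀ u, 0 ≤ weight u
  weight_sum : ∑ u, weight u = 1

namespace ClassicalAlgorithm

variable {N : ℕ} (A : ClassicalAlgorithm N)

open Classical in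
/-- The effect of a call of the oracle on the memory, `|x, 0⟩ ↦ |x, f x⟩`. (The oracle is only
defined if the answer register is `0`; see `QueriesAdmissible`.) -/
def oracleCall (f : Bits N → Bits N) (z : Bits A.width) : Bits A.width := fun w =>
  if h : ∃ i, A.ans i = w then f (fun j => z (A.inp j)) h.choose else z w

/-- The memory just before the operation `u k`; it starts in the all-zero string. -/
def memBefore (u : GateSequence A.width A.queries) (f : Bits N → Bits N) :
    Fin (A.queries + 1) → Bits A.width :=
  Fin.induction (motive := fun _ => Bits A.width) (zeroBits A.width) fun k z =>
    if A.active k (u k.castSucc z) then A.oracleCall f (u k.castSucc z) else u k.castSucc z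

/-- The memory just after the operation `u k`. -/
def memAfter (u : GateSequence A.width A.queries) (f : Bits N → Bits N)
    (k : Fin (A.queries + 1)) : Bits A.width :=
  u k (A.memBefore u f k)

/-- The memory after all operations, before the output. -/
def finalMem (u : GateSequence A.width A.queries) (f : Bits N → Bits N) : Bits A.width :=
  A.memAfter u f (Fin.last A.queries)

/-- The output: the bit that the final swap moves into the output register. -/
def output (u : GateSequence A.width A.queries) (f : Bits N → Bits N) : Bool :=
  A.finalMem u f A.out

/-- The memory after the final swap with an output register that was prepared in `0`. -/
def memAfterOutput (u : GateSequence A.width A.queries) (f : Bits N → Bits N) : Bits A.width :=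
  Function.update (A.finalMem u f) A.out false

/-- The oracle is called only on `|x, 0⟩`, its behaviour on `|x, y⟩` with `y ≠ 0` being
undefined. -/
def QueriesAdmissible : Prop :=
  ∀ u, A.weight u ≠ 0 → ∀ (b : Bool) (s : Bits N) (f : Bits N → Bits N),
    s ≠ zeroBits N → IsSimonFunction b s f →
    ∀ k : Fin A.queries, A.active k (A.memAfter u f k.castSucc) = true →
      ∀ i, A.memAfter u f k.castSucc (A.ans i) = false

/-- The average over the randomness of the algorithm and over `s`, `b` and `f`. -/
def expect (g : GateSequence A.width A.queries → Bool → (Bits N → Bits N) → ℝ) : ℝ :=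
  ∑ u, ∑ b : Bool, ∑ s : Bits N, ∑ f : Bits N → Bits N,
    A.weight u * simonWeight b s f * g u b f

/-- The average probability of the event `a = b`. -/
def successProb : ℝ := A.expect fun u b f => if A.output u f = b then 1 else 0

/-- The algorithm solves Simon's decision problem. -/
def SolvesSimon : Prop := A.QueriesAdmissible ∧ 2 / 3 ≤ A.successProb

/-- The joint probability that the output is `a` and that the memory after the output, before the
erasure, is `z`. It is `p(a)` times the diagonal entry of the conditional state `ρ_a^C`. -/
def jointProb (a : Bool) (z : Bits A.width) : ℝ :=
  A.expect fun u _ f => if A.output u f = a ∧ A.memAfterOutput u f = z then 1 else 0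

/-- The distribution of the output. -/
def outputProb (a : Bool) : ℝ := ∑ z, A.jointProb a z

/-- `S(C|a) = ∑ₐ p(a) S(ρ_a^C)`, the entropy (in nats) of the memory before the erasure given the
output. As `ρ_a^C` is diagonal, `S(ρ) = -tr (ρ ln ρ)` is the sum of `-p ln p` over its diagonal. -/
def condEntropy : ℝ :=
  ∑ a, A.outputProb a * ∑ z, Real.negMulLog (A.jointProb a z / A.outputProb a)

end ClassicalAlgorithm

/-! ### Reinitialization of the memory with a thermal bath -/

/-- A protocol that reinitializes `W` bits: a bath (a finite-dimensional quantum system) with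
Hamiltonian `ham`, and for each output `a` a unitary on memory and bath, which is applied by the
agent who knows `a`. -/
structure ErasureProtocol (W : ℕ) where
  dim : ℕ
  dim_pos : 0 < dim
  ham : Matrix (Fin dim) (Fin dim) ℂ
  ham_isHermitian : ham.IsHermitian
  gate : Bool → Matrix.unitaryGroup (Bits W × Fin dim) ℂ

/-- The Gibbs state `e^{-βH} / tr e^{-βH}`. -/
def gibbs {d : ℕ} (β : ℝ) (H : Matrix (Fin d) (Fin d) ℂ) : Matrix (Fin d) (Fin d) ℂ :=
  (NormedSpace.exp (-(β : ℂ) • H)).trace⁻¹ • NormedSpace.exp (-(β : ℂ) • H)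

/-- Nonnegative control costs of the operations `U_k`, of the pairs of swaps for the oracle calls,
of the output swap, and of the erasure. -/
structure ControlCosts (M : ℕ) where
  ops : Fin (M + 1) → ℝ≥0
  input : Fin M → ℝ≥0
  output : ℝ≥0
  erasure : ℝ≥0

/-- The energy of a bit string, if bit `w` in state `b` has energy `level w b`. -/
def memEnergy {W : ℕ} (level : Fin W → Bool → ℝ) (z : Bits W) : ℝ := ∑ w, level w (z w)

/-- The Hamiltonian of the memory, a sum of one-bit Hamiltonians that are diagonal in the
computational basis. -/
def memHam {W : ℕ} (level : Fin W → Bool → ℝ) : Matrix (Bits W) (Bits W) ℂ :=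
  Matrix.diagonal fun z => (memEnergy level z : ℂ)

/-- Partial trace over the bath. -/
def traceBath {W d : ℕ} (ρ : Matrix (Bits W × Fin d) (Bits W × Fin d) ℂ) :
    Matrix (Bits W) (Bits W) ℂ := fun z z' => ∑ e, ρ (z, e) (z', e)

/-- Partial trace over the memory. -/
def traceMem {W d : ℕ} (ρ : Matrix (Bits W × Fin d) (Bits W × Fin d) ℂ) :
    Matrix (Fin d) (Fin d) ℂ := fun e e' => ∑ z, ρ (z, e) (z, e')

namespace ClassicalAlgorithm

variable {N : ℕ} (A : ClassicalAlgorithm N)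

/-- The state `p(a) ρ_a^C`, as a diagonal matrix. -/
def subState (a : Bool) : Matrix (Bits A.width) (Bits A.width) ℂ :=
  Matrix.diagonal fun z => (A.jointProb a z : ℂ)

/-- The average state of the memory before the erasure. -/
def stateBefore : Matrix (Bits A.width) (Bits A.width) ℂ := ∑ a, A.subState a

/-- The average state of memory and bath after the erasure. -/
def jointStateAfter (β : ℝ) (P : ErasureProtocol A.width) :
    Matrix (Bits A.width × Fin P.dim) (Bits A.width × Fin P.dim) ℂ :=
  ∑ a, (P.gate a : Matrix (Bits A.width × Fin P.dim) (Bits A.width × Fin P.dim) ℂ) *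
    (A.subState a ⊗ₖ gibbs β P.ham) *
    (P.gate a : Matrix (Bits A.width × Fin P.dim) (Bits A.width × Fin P.dim) ℂ).conjTranspose

/-- The average state of the memory after the erasure. -/
def stateAfter (β : ℝ) (P : ErasureProtocol A.width) :
    Matrix (Bits A.width) (Bits A.width) ℂ :=
  traceBath (A.jointStateAfter β P)

/-- `⟨0| ρ_w |0⟩`, where `ρ_w` is the reduced state of bit `w` after the erasure. -/
def fidelity (β : ℝ) (P : ErasureProtocol A.width) (w : Fin A.width) : ℝ :=
  ∑ z : Bits A.width, if z w = false then (A.stateAfter β P z z).re else 0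

/-- Each bit is reset to `0` up to infidelity at most `ε`. -/
def Reinitializes (β ε : ℝ) (P : ErasureProtocol A.width) : Prop :=
  ∀ w, 1 - ε ≤ A.fidelity β P w

/-- The heat `Q_E = tr [H_E (ρ'_E - τ_E)]` that the erasure dissipates into the bath. -/
def bathHeat (β : ℝ) (P : ErasureProtocol A.width) : ℝ :=
  (P.ham * (traceMem (A.jointStateAfter β P) - gibbs β P.ham)).trace.re

variable (level : Fin A.width → Bool → ℝ)

/-- The energy change of the memory caused by the operation `U_k`. -/
def deltaOp (k : Fin (A.queries + 1)) : ℝ :=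
  A.expect fun u _ f => memEnergy level (A.memAfter u f k) - memEnergy level (A.memBefore u f k)

/-- The energy that flows from the input system into the memory during the `k`-th oracle call. -/
def deltaIn (k : Fin A.queries) : ℝ :=
  A.expect fun u _ f =>
    memEnergy level (A.memBefore u f k.succ) - memEnergy level (A.memAfter u f k.castSucc)

/-- The energy that the output swap transfers into the output register, a bit which was prepared
in `0` and has the same Hamiltonian as the bit it is swapped with. -/
def deltaOut : ℝ :=
  A.expect fun u _ f => level A.out (A.output u f) - level A.out false

/-- The energy change of the memory caused by the erasure, `tr [H (ρ' - ρ)]`. -/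
def deltaErasure (β : ℝ) (P : ErasureProtocol A.width) : ℝ :=
  (memHam level * (A.stateAfter β P - A.stateBefore)).trace.re

/-- The work that the agent invests into all operations. -/
def gateWork (β : ℝ) (K : ControlCosts A.queries) (P : ErasureProtocol A.width) : ℝ :=
  (∑ k, (A.deltaOp level k + (K.ops k : ℝ))) + (∑ k, (K.input k : ℝ)) + (K.output : ℝ) +
    (A.deltaErasure level β P + (K.erasure : ℝ) + A.bathHeat β P)

/-- The (average) energy consumption `W_gates + ΔE_in - ΔE_out` of the computation. -/
def energyConsumption (β : ℝ) (K : ControlCosts A.queries) (P : ErasureProtocol A.width) : ℝ :=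
  A.gateWork level β K P + (∑ k, A.deltaIn level k) - A.deltaOut level

end ClassicalAlgorithm

/-! ### The explicit bound -/

/-- The constant factor of the leading order of the bound, as a function of `Δ`. -/
def leadingFactor (Δ : ℝ) : ℝ :=
  (1 - 6 * Δ) / (6 - 12 * Δ) * √(2 * Δ / (1 + Δ))

/-- The explicit lower bound on the entropy, with its free parameter `Δ`. -/
def entropyBound (N : ℕ) (Δ : ℝ) : ℝ :=
  (1 - 6 * Δ) / (6 - 12 * Δ) *
    (√(2 * Δ / (1 + Δ)) * (2 : ℝ) ^ ((N : ℝ) / 2) * (N * Real.log 2 - 1) - 1) - Real.log 2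

end SimonThermo

end

open SimonThermo

/-! The energy balance of the cycle telescopes: all energies of the bits cancel, except for what
imperfectly reset bits keep, so the agent pays at least for the heat (`le_energyConsumption`). The
heat is bounded by Landauer's principle, `β Q ≥ S(C|a)` up to an error that vanishes with the
infidelity. No quantum entropies are needed for it: in the basis of eigenvectors of the bath
Hamiltonian the initial state is diagonal, only the diagonal of the final state matters, and the
two are related by a doubly stochastic matrix. Klein's inequality (`sum_mul_log_diag_conj_le`) is
applied with a reference state that is the Gibbs state on the bath and a product of independent,
slightly noisy zeros on the memory; the logarithm of the latter is a sum of one-bit terms, so its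
mean is controlled by the fidelities (`condEntropy_add_le_bathHeat`, `exists_landauer_bound`).

The entropy is large because the operations are reversible. For a fixed sequence of operations, the
output and the memory determine all the values of `f` that were obtained
(`eq_on_queried_of_output_eq`). If `f` is a random permutation of `n = 2 ^ N` strings and more than
`m` values were obtained, each final memory has probability at most `(n - m - 1)! / n!`, which
gives about `(m + 1) log n` nats. Concavity of the entropy reduces the general case to this one.

It remains to see that many values are needed. As long as no two arguments that differ by `s` have
been queried, the answers for `b = 1` have the same distribution as those for `b = 0`. This is shown
by an explicit bijection of permutations (`card_filter_comp_eq`). Among `m` arguments a random `s`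
causes a collision with probability at most `m (m - 1) / (2 (n - 1))`, so success probability `2/3`
forces more than `m` values to be obtained, for `b = 0`, with probability at least `1/3` minus this
number (`sum_output_eq_le`). Taking `m ≈ √(2Δ / (1 + Δ)) 2 ^ (N / 2)` yields the explicit bound. -/

noncomputable section

namespace SimonThermo

namespace ClassicalAlgorithm

variable {N : ℕ} (A : ClassicalAlgorithm N)

/-! ### The set of queried points -/

/-- The content of the input register at the `k`-th oracle call. -/
def queryPoint (u : GateSequence A.width A.queries) (f : Bits N → Bits N) (k : Fin A.queries) :
    Bits N := fun j => A.memAfter u f k.castSucc (A.inp j)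

/-- The set of arguments at which `f` is evaluated during the calls with index less than `i`. -/
def queried (u : GateSequence A.width A.queries) (f : Bits N → Bits N) (i : ℕ) :
    Finset (Bits N) :=
  (Finset.univ.filter fun k : Fin A.queries =>
    k.val < i ∧ A.active k (A.memAfter u f k.castSucc) = true).image (A.queryPoint u f)

/-- Whenever the oracle is called during the run on `f`, the answer register is `0`. -/
def CleanRun (u : GateSequence A.width A.queries) (f : Bits N → Bits N) : Prop :=
  ∀ k : Fin A.queries, A.active k (A.memAfter u f k.castSucc) = true →
    ∀ i, A.memAfter u f k.castSucc (A.ans i) = false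

variable (u : GateSequence A.width A.queries) {f f' : Bits N → Bits N}

lemma memBefore_succ (f : Bits N → Bits N) (k : Fin A.queries) :
    A.memBefore u f k.succ = if A.active k (A.memAfter u f k.castSucc) = true then
      A.oracleCall f (A.memAfter u f k.castSucc) else A.memAfter u f k.castSucc := rfl

lemma oracleCall_ans (f : Bits N → Bits N) (z : Bits A.width) (i : Fin N) :
    A.oracleCall f z (A.ans i) = f (fun j => z (A.inp j)) i := by
  have h : ∃ j, A.ans j = A.ans i := ⟨i, rfl⟩
  simp only [oracleCall, dif_pos h]
  rw [A.ans.injective h.choose_spec]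

lemma oracleCall_of_notMem (f : Bits N → Bits N) (z : Bits A.width) {w : Fin A.width}
    (hw : w ∉ Set.range A.ans) : A.oracleCall f z w = z w :=
  dif_neg hw

lemma oracleCall_congr {z : Bits A.width} (h : f (fun j => z (A.inp j)) = f' fun j => z (A.inp j)) :
    A.oracleCall f z = A.oracleCall f' z := by
  funext w
  simp only [oracleCall, h]

lemma queried_mono (f : Bits N → Bits N) {i j : ℕ} (h : i ≤ j) :
    A.queried u f i ⊆ A.queried u f j := by
  refine Finset.image_subset_image fun k hk => ?_
  simp only [Finset.mem_filter, Finset.mem_univ, true_and] at hk ⊢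
  exact ⟨hk.1.trans_le h, hk.2⟩

lemma queryPoint_mem_queried {f : Bits N → Bits N} {i : ℕ} {k : Fin A.queries} (hk : k.val < i)
    (ha : A.active k (A.memAfter u f k.castSucc) = true) :
    A.queryPoint u f k ∈ A.queried u f i :=
  Finset.mem_image_of_mem _ (by simp [hk, ha])

lemma queried_zero (f : Bits N → Bits N) : A.queried u f 0 = ∅ := by
  simp [queried]

/-- The run depends on `f` only through its values at the points that are queried. -/
lemma memBefore_congr {i : ℕ} (h : ∀ x ∈ A.queried u f i, f' x = f x) (k : Fin (A.queries + 1))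
    (hk : k.val ≤ i) : A.memBefore u f' k = A.memBefore u f k := by
  induction k using Fin.induction with
  | zero => rfl
  | succ k ih =>
    have hlt : k.val < i := by simpa using hk
    have e : A.memAfter u f' k.castSucc = A.memAfter u f k.castSucc := by
      simp only [memAfter]
      rw [ih (by simpa using hlt.le)]
    rw [memBefore_succ, memBefore_succ, e]
    split_ifs with ha
    · exact A.oracleCall_congr (h _ (A.queryPoint_mem_queried u hlt ha))
    · rfl

/-- The decision whether and where to make the next call depends only on earlier answers, which
is why `j` may be `i + 1`. -/
lemma queried_congr {i j : ℕ} (h : ∀ x ∈ A.queried u f i, f' x = f x) (hj : j ≤ i + 1) :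
    A.queried u f' j = A.queried u f j := by
  have e : ∀ k : Fin A.queries, k.val < j →
      A.memAfter u f' k.castSucc = A.memAfter u f k.castSucc := by
    intro k hk
    simp only [memAfter]
    rw [A.memBefore_congr u h k.castSucc (by simp; omega)]
  have hq : ∀ k : Fin A.queries, k.val < j → A.queryPoint u f' k = A.queryPoint u f k :=
    fun k hk => by funext j; simp only [queryPoint, e k hk]
  ext x
  simp only [queried, Finset.mem_image, Finset.mem_filter, Finset.mem_univ, true_and]
  constructor
  · rintro ⟨k, ⟨hk, ha⟩, rfl⟩
    exact ⟨k, ⟨hk, by rwa [e k hk] at ha⟩, (hq k hk).symm⟩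
  · rintro ⟨k, ⟨hk, ha⟩, rfl⟩
    exact ⟨k, ⟨hk, by rwa [e k hk]⟩, hq k hk⟩

lemma output_congr (h : ∀ x ∈ A.queried u f A.queries, f' x = f x) :
    A.output u f' = A.output u f := by
  simp only [output, finalMem, memAfter]
  rw [A.memBefore_congr u h _ (by simp)]

/-- The operations are reversible and a call leaves its argument in the memory, so the memory
determines the values of `f` that were obtained. -/
lemma eq_on_queried_of_memBefore_eq (hf : A.CleanRun u f) (hf' : A.CleanRun u f')
    (k : Fin (A.queries + 1)) (h : A.memBefore u f k = A.memBefore u f' k) :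
    ∀ x ∈ A.queried u f k.val, f' x = f x := by
  induction k using Fin.induction with
  | zero => simp [queried_zero]
  | succ k ih =>
    have hout : ∀ (g : Bits N → Bits N) (w : Fin A.width), w ∉ Set.range A.ans →
        A.memBefore u g k.succ w = A.memAfter u g k.castSucc w := by
      intro g w hw
      rw [memBefore_succ]
      split_ifs
      · exact A.oracleCall_of_notMem g _ hw
      · rfl
    have hw : ∀ w, w ∉ Set.range A.ans →
        A.memAfter u f k.castSucc w = A.memAfter u f' k.castSucc w := fun w hw => by
      rw [← hout f w hw, ← hout f' w hw, h]
    have hact := A.active_congr k _ _ hw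
    have hinp : A.queryPoint u f k = A.queryPoint u f' k := by
      funext j
      exact hw _ (by rintro ⟨i, hi⟩; exact A.inp_ne_ans j i hi.symm)
    have hmem : A.memAfter u f k.castSucc = A.memAfter u f' k.castSucc := by
      by_cases ha : A.active k (A.memAfter u f k.castSucc) = true
      · funext w
        by_cases hr : w ∈ Set.range A.ans
        · obtain ⟨i, rfl⟩ := hr
          rw [hf k ha i, hf' k (hact ▸ ha) i]
        · exact hw w hr
      · rw [memBefore_succ, memBefore_succ, if_neg ha, if_neg (hact ▸ ha)] at h
        exact h
    have hprev : A.memBefore u f k.castSucc = A.memBefore u f' k.castSucc :=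
      (u k.castSucc).injective hmem
    intro x hx
    simp only [queried, Finset.mem_image, Finset.mem_filter, Finset.mem_univ, true_and] at hx
    obtain ⟨l, ⟨hl, ha⟩, rfl⟩ := hx
    rcases Nat.lt_succ_iff_lt_or_eq.mp hl with hlk | hlk
    · exact ih hprev _ (A.queryPoint_mem_queried u (by simpa using hlk) ha)
    · obtain rfl : l = k := Fin.ext hlk
      rw [memBefore_succ, memBefore_succ, if_pos ha, if_pos (hact ▸ ha)] at h
      funext i
      have hi := congrFun h (A.ans i)
      rw [oracleCall_ans, oracleCall_ans] at hi
      change f (A.queryPoint u f l) i = f' (A.queryPoint u f' l) i at hi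
      rw [← hinp] at hi
      exact hi.symm

/-- Together, the output and the memory after the output swap determine the values of `f` that
were obtained. -/
lemma eq_on_queried_of_output_eq (hf : A.CleanRun u f) (hf' : A.CleanRun u f')
    (ho : A.output u f = A.output u f') (hm : A.memAfterOutput u f = A.memAfterOutput u f') :
    ∀ x ∈ A.queried u f A.queries, f' x = f x := by
  have hfin : A.finalMem u f = A.finalMem u f' := by
    funext w
    by_cases hw : w = A.out
    · subst hw; exact ho
    · have := congrFun hm w
      simpa [memAfterOutput, Function.update_of_ne hw] using this
  have := A.eq_on_queried_of_memBefore_eq u hf hf' (Fin.last _) ((u _).injective hfin)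
  simpa using this

/-- The number of calls after which the run on `f` is cut off: the largest number of calls
that evaluate `f` at no more than `m` distinct points. -/
def cutoff (m : ℕ) (f : Bits N → Bits N) : ℕ :=
  Nat.findGreatest (fun i => (A.queried u f i).card ≤ m) A.queries

/-- The points that are queried in the run that is cut off before it evaluates `f` at more than
`m` distinct points. -/
def queriedUpTo (m : ℕ) (f : Bits N → Bits N) : Finset (Bits N) :=
  A.queried u f (A.cutoff u m f)

lemma card_queriedUpTo_le (m : ℕ) (f : Bits N → Bits N) : (A.queriedUpTo u m f).card ≤ m :=
  Nat.findGreatest_spec (P := fun i => (A.queried u f i).card ≤ m) (Nat.zero_le _)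
    (by simp [queried_zero])

lemma cutoff_congr {m : ℕ} (h : ∀ x ∈ A.queriedUpTo u m f, f' x = f x) :
    A.cutoff u m f' = A.cutoff u m f := by
  refine Nat.findGreatest_eq_iff.mpr ⟨Nat.findGreatest_le _, fun _ => ?_, fun i hi hi' hc => ?_⟩
  · rw [A.queried_congr u h (Nat.le_succ _)]
    exact A.card_queriedUpTo_le u m f
  · have h1 : (A.queried u f (A.cutoff u m f + 1)).card ≤ m := by
      rw [← A.queried_congr u h le_rfl]
      exact (Finset.card_le_card (A.queried_mono u f' hi)).trans hc
    have h2 : A.cutoff u m f + 1 ≤ A.cutoff u m f :=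
      Nat.le_findGreatest (P := fun i => (A.queried u f i).card ≤ m) (by omega) h1
    omega

lemma queriedUpTo_congr {m : ℕ} (h : ∀ x ∈ A.queriedUpTo u m f, f' x = f x) :
    A.queriedUpTo u m f' = A.queriedUpTo u m f := by
  rw [queriedUpTo, A.cutoff_congr u h]
  exact A.queried_congr u h (Nat.le_succ _)

lemma card_queried_le_iff_cutoff (m : ℕ) (f : Bits N → Bits N) :
    (A.queried u f A.queries).card ≤ m ↔ A.cutoff u m f = A.queries := by
  refine ⟨fun h => le_antisymm (Nat.findGreatest_le _)
    (Nat.le_findGreatest (P := fun i => (A.queried u f i).card ≤ m) le_rfl h), fun h => ?_⟩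
  have := A.card_queriedUpTo_le u m f
  rwa [queriedUpTo, h] at this

/-- Whether more than `m` points are queried, and the output if not, can be read off the run that
is cut off. -/
lemma long_or_output_congr {m : ℕ} (h : ∀ x ∈ A.queriedUpTo u m f, f' x = f x) (a : Bool) :
    ((A.queried u f' A.queries).card ≤ m → A.output u f' = a) ↔
      ((A.queried u f A.queries).card ≤ m → A.output u f = a) := by
  rw [card_queried_le_iff_cutoff, card_queried_le_iff_cutoff, A.cutoff_congr u h]
  refine forall_congr' fun hc => ?_
  rw [A.output_congr u]
  intro x hx
  exact h x (by rwa [queriedUpTo, hc])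

end ClassicalAlgorithm

/-! ### Uniformly random permutations -/

section Permutations

variable {X : Type*} [Fintype X] [DecidableEq X]

lemma exists_perm_eqOn {g : X → X} {D : Finset X} (hg : Set.InjOn g D) :
    ∃ π : Equiv.Perm X, ∀ x ∈ D, π x = g x := by
  obtain ⟨e, he⟩ := Finset.exists_equiv_extend_of_card_eq (α := X) (t := Finset.univ)
    (Finset.card_univ (α := X)).symm (s := D) (f := g) (Finset.subset_univ _) hg
  refine ⟨e.trans (Equiv.subtypeUnivEquiv fun x => Finset.mem_univ x), fun x hx => ?_⟩
  simpa using he x hx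

open Classical in
/-- Deferred decisions: let an exploration reveal the values of a function on a set `R f` that
depends only on the revealed values. For uniformly random `σ`, exploring `σ ∘ g` without meeting a
collision of `g` looks exactly like exploring `σ` itself: replace `σ` by `σ ∘ π`, where the
permutation `π`, which depends only on the explored set, agrees with `g` there. -/
lemma card_filter_comp_eq (R : (X → X) → Finset X)
    (hR : ∀ f f', (∀ x ∈ R f, f' x = f x) → R f' = R f) (G : (X → X) → Prop)
    (hG : ∀ f f', (∀ x ∈ R f, f' x = f x) → (G f' ↔ G f)) (g : X → X) :
    (Finset.univ.filter fun σ : Equiv.Perm X => G (σ ∘ g) ∧ Set.InjOn g (R (σ ∘ g))).card =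
      (Finset.univ.filter fun σ : Equiv.Perm X => G σ ∧ Set.InjOn g (R σ)).card := by
  have hex : ∀ D : Finset X, ∃ π : Equiv.Perm X, Set.InjOn g D → ∀ x ∈ D, π x = g x := by
    intro D
    by_cases h : Set.InjOn g D
    · obtain ⟨π, hπ⟩ := exists_perm_eqOn h
      exact ⟨π, fun _ => hπ⟩
    · exact ⟨1, fun h' => absurd h' h⟩
  choose π hπ using hex
  have h1 : ∀ σ : Equiv.Perm X, Set.InjOn g (R (σ ∘ g)) →
      ∀ x ∈ R (σ ∘ g), (σ * π (R (σ ∘ g))) x = (σ ∘ g) x := by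
    intro σ hσ x hx
    simp [hπ _ hσ x hx]
  have h2 : ∀ σ : Equiv.Perm X, Set.InjOn g (R σ) →
      ∀ x ∈ R σ, ((σ * (π (R σ))⁻¹ : Equiv.Perm X) ∘ g) x = σ x := by
    intro σ hσ x hx
    simp [← hπ _ hσ x hx]
  refine Finset.card_bij' (fun σ _ => σ * π (R (σ ∘ g))) (fun σ _ => σ * (π (R σ))⁻¹) ?_ ?_ ?_ ?_
  · intro σ hσ
    simp only [Finset.mem_filter, Finset.mem_univ, true_and] at hσ ⊢
    have h := h1 σ hσ.2
    exact ⟨(hG _ _ h).mpr hσ.1, by rw [hR _ _ h]; exact hσ.2⟩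
  · intro σ hσ
    simp only [Finset.mem_filter, Finset.mem_univ, true_and] at hσ ⊢
    have h := h2 σ hσ.2
    exact ⟨(hG _ _ h).mpr hσ.1, by rw [hR _ _ h]; exact hσ.2⟩
  · intro σ hσ
    simp only [Finset.mem_filter, Finset.mem_univ, true_and] at hσ
    simp only [hR _ _ (h1 σ hσ.2), mul_inv_cancel_right]
  · intro σ hσ
    simp only [Finset.mem_filter, Finset.mem_univ, true_and] at hσ
    simp only [hR _ _ (h2 σ hσ.2), inv_mul_cancel_right]

lemma card_perm_eqOn_le (σ₀ : Equiv.Perm X) {Q : Finset X} {k : ℕ} (hk : k ≤ Q.card) :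
    (Finset.univ.filter fun σ : Equiv.Perm X => ∀ x ∈ Q, σ x = σ₀ x).card ≤
      (Fintype.card X - k).factorial := by
  have hle : (Finset.univ.filter fun σ : Equiv.Perm X => ∀ x ∈ Q, σ x = σ₀ x).card ≤
      (Finset.univ.filter fun σ : Equiv.Perm X => ∀ x, ¬ x ∉ Q → σ x = x).card := by
    refine Finset.card_le_card_of_injOn (fun σ => σ₀⁻¹ * σ) ?_ ?_
    · intro σ hσ
      simp only [Finset.coe_filter, Finset.mem_univ, true_and, Set.mem_ofPred_eq] at hσ ⊢
      intro x hx
      simp [hσ x (not_not.mp hx)]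
    · intro σ _ τ _ h
      simpa using h
  have hcard : (Finset.univ.filter fun σ : Equiv.Perm X => ∀ x, ¬ x ∉ Q → σ x = x).card =
      (Fintype.card X - Q.card).factorial := by
    rw [← Fintype.card_subtype,
      Fintype.card_congr (Equiv.Perm.subtypeEquivSubtypePerm (fun x => x ∉ Q)).symm,
      Fintype.card_perm]
    simp
  rw [hcard] at hle
  exact hle.trans (Nat.factorial_le (by omega))

/-- The mean of `F` over all permutations. -/
def permMean (F : Equiv.Perm X → ℝ) : ℝ := (∑ σ, F σ) / Fintype.card (Equiv.Perm X)

lemma permMean_mono {F G : Equiv.Perm X → ℝ} (h : ∀ σ, F σ ≤ G σ) : permMean F ≤ permMean G :=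
  div_le_div_of_nonneg_right (Finset.sum_le_sum fun σ _ => h σ) (Nat.cast_nonneg _)

lemma permMean_nonneg {F : Equiv.Perm X → ℝ} (h : ∀ σ, 0 ≤ F σ) : 0 ≤ permMean F :=
  div_nonneg (Finset.sum_nonneg fun σ _ => h σ) (Nat.cast_nonneg _)

lemma permMean_add (F G : Equiv.Perm X → ℝ) :
    permMean (fun σ => F σ + G σ) = permMean F + permMean G := by
  simp only [permMean, Finset.sum_add_distrib, add_div]

lemma permMean_const (c : ℝ) : permMean (fun _ : Equiv.Perm X => c) = c := by
  have : (Fintype.card (Equiv.Perm X) : ℝ) ≠ 0 := Nat.cast_ne_zero.mpr Fintype.card_ne_zero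
  simp [permMean, Finset.card_univ, mul_div_cancel_left₀ _ this]

lemma permMean_sum {ι : Type*} (s : Finset ι) (F : ι → Equiv.Perm X → ℝ) :
    permMean (fun σ => ∑ i ∈ s, F i σ) = ∑ i ∈ s, permMean (F i) := by
  simp only [permMean, Finset.sum_div]
  rw [Finset.sum_comm]

end Permutations

/-! ### Averages over Simon functions -/

variable {N : ℕ}

lemma bxor_eq_iff {x y s : Bits N} : y = bxor x s ↔ s = bxor x y := by
  constructor <;> rintro rfl <;> funext i <;> simp [bxor]

lemma bxor_comm (x y : Bits N) : bxor x y = bxor y x := by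
  funext i; simp [bxor, Bool.xor_comm]

lemma bxor_bxor (x s : Bits N) : bxor (bxor x s) s = x := by
  funext i; simp [bxor]

lemma card_bits : Fintype.card (Bits N) = 2 ^ N := by simp

lemma two_pow_sub_one_pos (hN : 0 < N) : (0 : ℝ) < 2 ^ N - 1 :=
  sub_pos.mpr (one_lt_pow₀ one_lt_two hN.ne')

lemma IsSimonFunction.perm_comp {b : Bool} {s : Bits N} {f : Bits N → Bits N}
    (hf : IsSimonFunction b s f) (σ : Equiv.Perm (Bits N)) : IsSimonFunction b s (σ ∘ f) := by
  cases b with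
  | false => exact σ.injective.comp hf
  | true => intro x y; simpa using hf x y

/-- There is a function for every `s ≠ 0`: send `x` to the representative of `{x, x ⊕ s}` whose
bit at a fixed position of the support of `s` is `0`. -/
lemma exists_isSimonFunction (b : Bool) {s : Bits N} (hs : s ≠ zeroBits N) :
    ∃ f, IsSimonFunction b s f := by
  cases b with
  | false => exact ⟨id, Function.injective_id⟩
  | true =>
    obtain ⟨i, hi⟩ := Function.ne_iff.mp hs
    have hi : s i = true := by simpa [zeroBits] using hi
    refine ⟨fun x => if x i then bxor x s else x, fun x y => ?_⟩
    have hx : ∀ x, (bxor x s) i = !x i := by simp [bxor, hi]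
    constructor
    · intro h
      rcases hxi : x i <;> rcases hyi : y i <;> simp only [hxi, hyi] at h <;> simp at h
      · exact Or.inl h.symm
      · right; rw [h, bxor_bxor]
      · right; exact h.symm
      · left; rw [← bxor_bxor y s, ← h, bxor_bxor]
    · rintro (rfl | rfl)
      · rfl
      · rcases hxi : x i <;> simp [hx, hxi, bxor_bxor]

open Classical in
lemma sum_simonWeight_mul (b : Bool) {s : Bits N} (hs : s ≠ zeroBits N)
    (F : (Bits N → Bits N) → ℝ) :
    ∑ f, simonWeight b s f * F f = (1 / 2) * (1 / ((2 : ℝ) ^ N - 1)) *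
      ((∑ f : {g : Bits N → Bits N // IsSimonFunction b s g}, F f) /
        Fintype.card {g : Bits N → Bits N // IsSimonFunction b s g}) := by
  have h : ∀ f, simonWeight b s f * F f = if IsSimonFunction b s f then
      (1 / 2) * (1 / ((2 : ℝ) ^ N - 1)) *
      (1 / (Fintype.card {g : Bits N → Bits N // IsSimonFunction b s g} : ℝ)) * F f else 0 := by
    intro f
    by_cases hf : IsSimonFunction b s f
    · simp only [simonWeight, hs, hf, ne_eq, not_false_eq_true, and_self, if_true]
    · simp only [simonWeight, hf, and_false, if_false, zero_mul]
  rw [Finset.sum_congr rfl fun f _ => h f, ← Finset.sum_filter, ← Finset.mul_sum,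
    Finset.sum_subtype (p := IsSimonFunction b s) _ (by simp)]
  ring

lemma simonWeight_zeroBits (b : Bool) (f : Bits N → Bits N) :
    simonWeight b (zeroBits N) f = 0 := by
  simp [simonWeight]

lemma simonWeight_nonneg (b : Bool) (s : Bits N) (f : Bits N → Bits N) :
    0 ≤ simonWeight b s f := by
  unfold simonWeight
  split_ifs with h
  · have : (1 : ℝ) ≤ 2 ^ N := one_le_pow₀ one_le_two
    have : (0 : ℝ) ≤ 2 ^ N - 1 := by linarith
    positivity
  · exact le_rfl

lemma sum_ne_zeroBits_const (c : ℝ) :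
    ∑ _s ∈ Finset.univ.erase (zeroBits N), c = ((2 : ℝ) ^ N - 1) * c := by
  rw [Finset.sum_const, Finset.card_erase_of_mem (Finset.mem_univ _), Finset.card_univ, card_bits,
    nsmul_eq_mul, Nat.cast_sub Nat.one_le_two_pow]
  simp

lemma sum_simonWeight_eq_erase (b : Bool) (F : Bits N → (Bits N → Bits N) → ℝ) :
    ∑ s, ∑ f, simonWeight b s f * F s f =
      ∑ s ∈ Finset.univ.erase (zeroBits N), ∑ f, simonWeight b s f * F s f := by
  rw [← Finset.add_sum_erase _ _ (Finset.mem_univ (zeroBits N))]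
  simp [simonWeight_zeroBits]

lemma sum_simonWeight (hN : 0 < N) (b : Bool) : ∑ s : Bits N, ∑ f, simonWeight b s f = 1 / 2 := by
  classical
  have h := sum_simonWeight_eq_erase (N := N) b fun _ _ => 1
  simp only [mul_one] at h
  rw [h]
  have h' : ∀ s ∈ Finset.univ.erase (zeroBits N), ∑ f, simonWeight b s f =
      (1 / 2) * (1 / ((2 : ℝ) ^ N - 1)) := by
    intro s hs
    have hs' : s ≠ zeroBits N := Finset.ne_of_mem_erase hs
    have h1 := sum_simonWeight_mul b hs' fun _ => 1
    obtain ⟨f, hf⟩ := exists_isSimonFunction b hs'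
    have : Nonempty {g : Bits N → Bits N // IsSimonFunction b s g} := ⟨⟨f, hf⟩⟩
    have hc : (Fintype.card {g : Bits N → Bits N // IsSimonFunction b s g} : ℝ) ≠ 0 :=
      Nat.cast_ne_zero.mpr Fintype.card_ne_zero
    simpa [Finset.card_univ, div_self hc] using h1
  rw [Finset.sum_congr rfl h', sum_ne_zeroBits_const]
  have := (two_pow_sub_one_pos hN).ne'
  field_simp

/-- For `b = 0` the function is a uniformly random permutation. -/
lemma sum_simonWeight_false (hN : 0 < N) (F : (Bits N → Bits N) → ℝ) :
    ∑ s : Bits N, ∑ f, simonWeight false s f * F f =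
      1 / 2 * permMean fun σ : Equiv.Perm (Bits N) => F σ := by
  classical
  rw [sum_simonWeight_eq_erase false fun _ f => F f]
  have h' : ∀ s ∈ Finset.univ.erase (zeroBits N), ∑ f, simonWeight false s f * F f =
      (1 / 2) * (1 / ((2 : ℝ) ^ N - 1)) * permMean fun σ : Equiv.Perm (Bits N) => F σ := by
    intro s hs
    let e : Equiv.Perm (Bits N) ≃ {g : Bits N → Bits N // IsSimonFunction false s g} :=
      Equiv.ofBijective (fun σ => ⟨σ, σ.injective⟩)
        ⟨fun σ τ h => DFunLike.coe_injective (congrArg Subtype.val h), fun g =>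
          ⟨Equiv.ofBijective g.1 (Finite.injective_iff_bijective.mp g.2), rfl⟩⟩
    rw [sum_simonWeight_mul false (Finset.ne_of_mem_erase hs), permMean, Fintype.card_congr e,
      ← Equiv.sum_comp e]
    rfl
  rw [Finset.sum_congr rfl h', sum_ne_zeroBits_const]
  have := (two_pow_sub_one_pos hN).ne'
  field_simp

/-- Composing with a permutation preserves the distribution of `f`, so bounds for the average over
the permutations are bounds for the average over `f`. -/
lemma sum_simonWeight_true_le (F : (Bits N → Bits N) → ℝ) (B : Bits N → ℝ)
    (hB : ∀ s, 0 ≤ B s) (h : ∀ s f, s ≠ zeroBits N → IsSimonFunction true s f →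
      permMean (fun σ : Equiv.Perm (Bits N) => F (σ ∘ f)) ≤ B s) :
    ∑ s : Bits N, ∑ f, simonWeight true s f * F f ≤
      (1 / 2) * (1 / ((2 : ℝ) ^ N - 1)) * ∑ s ∈ Finset.univ.erase (zeroBits N), B s := by
  classical
  rw [sum_simonWeight_eq_erase true fun _ f => F f, Finset.mul_sum]
  refine Finset.sum_le_sum fun s hs => ?_
  have hs' : s ≠ zeroBits N := Finset.ne_of_mem_erase hs
  rw [sum_simonWeight_mul true hs']
  have hone : (0 : ℝ) ≤ 2 ^ N - 1 := sub_nonneg.mpr (one_le_pow₀ one_le_two)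
  refine mul_le_mul_of_nonneg_left (div_le_of_le_mul₀ (Nat.cast_nonneg _) (hB s) ?_) (by positivity)
  let S := {g : Bits N → Bits N // IsSimonFunction true s g}
  have hinv : ∀ σ : Equiv.Perm (Bits N), ∑ f : S, F (σ ∘ f.1) = ∑ f : S, F f.1 := by
    intro σ
    let e : S ≃ S :=
      { toFun := fun f => ⟨σ ∘ f.1, f.2.perm_comp σ⟩
        invFun := fun f => ⟨σ.symm ∘ f.1, f.2.perm_comp σ.symm⟩
        left_inv := fun f => Subtype.ext (by funext x; simp)
        right_inv := fun f => Subtype.ext (by funext x; simp) }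
    exact Equiv.sum_comp e fun f : S => F f.1
  calc ∑ f : S, F f.1
      = permMean fun σ : Equiv.Perm (Bits N) => ∑ f : S, F (σ ∘ f.1) := by
        simp only [hinv, permMean_const]
    _ = ∑ f : S, permMean fun σ : Equiv.Perm (Bits N) => F (σ ∘ f.1) := permMean_sum _ _
    _ ≤ ∑ _f : S, B s := Finset.sum_le_sum fun f _ => h s f.1 hs' f.2
    _ = B s * Fintype.card S := by
        rw [Finset.sum_const, Finset.card_univ, nsmul_eq_mul, mul_comm]

/-- Among `m` points there are collisions for at most `m (m - 1) / 2` shifts `s`. -/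
lemma sum_collision_le (D : Finset (Bits N)) {m : ℕ} (hD : D.card ≤ m) :
    ∑ s ∈ Finset.univ.erase (zeroBits N),
      (if ∃ x ∈ D, ∃ y ∈ D, x ≠ y ∧ y = bxor x s then (1 : ℝ) else 0) ≤ m * (m - 1) / 2 := by
  classical
  have hpt : ∀ s ∈ Finset.univ.erase (zeroBits N),
      2 * (if ∃ x ∈ D, ∃ y ∈ D, x ≠ y ∧ y = bxor x s then 1 else 0) ≤
        (D.offDiag.filter fun p => bxor p.1 p.2 = s).card := by
    intro s _
    split_ifs with h
    · obtain ⟨x, hx, y, hy, hxy, hs⟩ := h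
      have hs := bxor_eq_iff.mp hs
      have hne : (x, y) ≠ (y, x) := fun h => hxy (congrArg Prod.fst h)
      rw [mul_one, ← Finset.card_pair hne]
      refine Finset.card_le_card fun p hp => ?_
      rcases Finset.mem_insert.mp hp with rfl | hp
      · simp [hx, hy, hxy, hs]
      · rw [Finset.mem_singleton.mp hp]
        simp [hx, hy, hxy.symm, hs, bxor_comm]
    · simp
  have hsum : ∑ s ∈ Finset.univ.erase (zeroBits N),
      (D.offDiag.filter fun p => bxor p.1 p.2 = s).card ≤ D.offDiag.card := by
    rw [Finset.card_eq_sum_card_fiberwise (f := fun p : Bits N × Bits N => bxor p.1 p.2)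
      (t := Finset.univ) (by simp)]
    exact Finset.sum_le_sum_of_subset (Finset.subset_univ _)
  have hnat := (Finset.sum_le_sum hpt).trans hsum
  rw [← Finset.mul_sum, Finset.offDiag_card] at hnat
  have hcard : D.card * D.card - D.card ≤ m * m - m := by
    rw [← Nat.mul_sub_one, ← Nat.mul_sub_one]
    exact Nat.mul_le_mul hD (by omega)
  have hreal : (2 : ℝ) * ∑ s ∈ Finset.univ.erase (zeroBits N),
      (if ∃ x ∈ D, ∃ y ∈ D, x ≠ y ∧ y = bxor x s then (1 : ℝ) else 0) ≤ ((m * m - m : ℕ) : ℝ) := by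
    exact_mod_cast hnat.trans hcard
  rw [Nat.cast_sub (Nat.le_mul_self m), Nat.cast_mul] at hreal
  linarith

/-! ### The number of queries -/

namespace ClassicalAlgorithm

variable {N : ℕ} (A : ClassicalAlgorithm N) (u : GateSequence A.width A.queries)

open Classical in
/-- On a uniformly random Simon function with shift `s`, the run that is cut off looks as on a
uniformly random permutation, unless two of the points that it queries differ by `s`. -/
lemma permMean_output_comp_le (m : ℕ) {s : Bits N}
    {f : Bits N → Bits N} (hf : IsSimonFunction true s f) :
    permMean (fun σ : Equiv.Perm (Bits N) => if A.output u (σ ∘ f) = true then 1 else 0) ≤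
      permMean (fun σ : Equiv.Perm (Bits N) =>
        (if (A.queried u σ A.queries).card ≤ m → A.output u σ = true then 1 else 0) +
        if ∃ x ∈ A.queriedUpTo u m σ, ∃ y ∈ A.queriedUpTo u m σ, x ≠ y ∧ y = bxor x s
          then 1 else 0) := by
  let G : (Bits N → Bits N) → Prop := fun f => (A.queried u f A.queries).card ≤ m →
    A.output u f = true
  have hG : (Finset.univ.filter fun σ : Equiv.Perm (Bits N) => G (σ ∘ f) ∧
      Set.InjOn f (A.queriedUpTo u m (σ ∘ f))).card = (Finset.univ.filter fun
        σ : Equiv.Perm (Bits N) => G σ ∧ Set.InjOn f (A.queriedUpTo u m σ)).card := by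
    convert card_filter_comp_eq (A.queriedUpTo u m) (fun _ _ h => A.queriedUpTo_congr u h) G
      (fun _ _ h => A.long_or_output_congr u h true) f
  have hT : (Finset.univ.filter fun σ : Equiv.Perm (Bits N) => True ∧
      Set.InjOn f (A.queriedUpTo u m (σ ∘ f))).card = (Finset.univ.filter fun
        σ : Equiv.Perm (Bits N) => True ∧ Set.InjOn f (A.queriedUpTo u m σ)).card := by
    convert card_filter_comp_eq (A.queriedUpTo u m) (fun _ _ h => A.queriedUpTo_congr u h)
      (fun _ => True) (fun _ _ _ => Iff.rfl) f
  have key : ∀ (p q : Equiv.Perm (Bits N) → Prop) [DecidablePred p] [DecidablePred q],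
      permMean (fun σ => (if p σ ∧ q σ then (1 : ℝ) else 0) + if ¬ q σ then 1 else 0) =
        ((Finset.univ.filter fun σ => p σ ∧ q σ).card + (Fintype.card (Equiv.Perm (Bits N)) -
          (Finset.univ.filter fun σ => True ∧ q σ).card)) / Fintype.card (Equiv.Perm (Bits N)) := by
    intro p q _ _
    have hc := Finset.card_filter_add_card_filter_not (s := Finset.univ) q
    rw [Finset.card_univ] at hc
    simp only [permMean, Finset.sum_add_distrib, Finset.sum_boole, true_and, ← hc]
    push_cast
    ring
  calc permMean (fun σ : Equiv.Perm (Bits N) => if A.output u (σ ∘ f) = true then 1 else 0)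
      ≤ permMean (fun σ : Equiv.Perm (Bits N) =>
          (if G (σ ∘ f) ∧ Set.InjOn f (A.queriedUpTo u m (σ ∘ f)) then (1 : ℝ) else 0) +
            if ¬ Set.InjOn f (A.queriedUpTo u m (σ ∘ f)) then 1 else 0) := by
        refine permMean_mono fun σ => ?_
        by_cases ho : A.output u (σ ∘ f) = true
        · have : G (σ ∘ f) := fun _ => ho
          by_cases hi : Set.InjOn f (A.queriedUpTo u m (σ ∘ f)) <;> simp [ho, this, hi]
        · rw [if_neg ho]
          positivity
    _ = permMean (fun σ : Equiv.Perm (Bits N) =>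
          (if G σ ∧ Set.InjOn f (A.queriedUpTo u m σ) then (1 : ℝ) else 0) +
            if ¬ Set.InjOn f (A.queriedUpTo u m σ) then 1 else 0) := by
        rw [key (fun σ => G (σ ∘ f)) fun σ => Set.InjOn f (A.queriedUpTo u m (σ ∘ f)),
          key (fun σ => G σ) fun σ => Set.InjOn f (A.queriedUpTo u m σ), hG, hT]
    _ ≤ _ := by
        refine permMean_mono fun σ => add_le_add ?_ ?_
        · by_cases h : G σ
          · rw [if_pos h]
            split_ifs <;> norm_num
          · rw [if_neg (fun h' => h h'.1)]
            split_ifs <;> norm_num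
        · by_cases h : Set.InjOn f (A.queriedUpTo u m σ)
          · rw [if_neg (not_not.mpr h)]
            split_ifs <;> norm_num
          · have hc : ∃ x ∈ A.queriedUpTo u m σ, ∃ y ∈ A.queriedUpTo u m σ,
                x ≠ y ∧ y = bxor x s := by
              simp only [Set.InjOn, not_forall] at h
              obtain ⟨x, hx, y, hy, hxy, hne⟩ := h
              exact ⟨x, hx, y, hy, hne, ((hf x y).mp hxy).resolve_left fun h => hne h.symm⟩
            rw [if_pos h, if_pos hc]

open Classical in
/-- A run that solves the problem must either evaluate `f` at more than `m` points or meet a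
collision among at most `m` points; otherwise the two values of `b` look the same to it. -/
lemma sum_output_eq_le (hN : 0 < N) (m : ℕ) :
    ∑ b : Bool, ∑ s : Bits N, ∑ f, simonWeight b s f * (if A.output u f = b then 1 else 0) ≤
      1 / 2 * (1 + permMean (fun σ : Equiv.Perm (Bits N) =>
        if m < (A.queried u σ A.queries).card then 1 else 0) +
          m * (m - 1) / 2 / ((2 : ℝ) ^ N - 1)) := by
  have hn := two_pow_sub_one_pos hN
  rw [Fintype.sum_bool, sum_simonWeight_false hN]
  let g : Equiv.Perm (Bits N) → ℝ := fun σ =>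
    if (A.queried u σ A.queries).card ≤ m → A.output u σ = true then 1 else 0
  let c : Bits N → Equiv.Perm (Bits N) → ℝ := fun s σ =>
    if ∃ x ∈ A.queriedUpTo u m σ, ∃ y ∈ A.queriedUpTo u m σ, x ≠ y ∧ y = bxor x s then 1 else 0
  have h1 : ∑ s : Bits N, ∑ f, simonWeight true s f * (if A.output u f = true then 1 else 0) ≤
      (1 / 2) * (1 / ((2 : ℝ) ^ N - 1)) *
        ∑ s ∈ Finset.univ.erase (zeroBits N), permMean (fun σ => g σ + c s σ) := by
    refine sum_simonWeight_true_le _ _ (fun s => permMean_nonneg fun σ => ?_) fun s f _ hf =>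
      A.permMean_output_comp_le u m hf
    simp only [g, c]
    positivity
  have h2 : ∑ s ∈ Finset.univ.erase (zeroBits N), permMean (fun σ => g σ + c s σ) ≤
      ((2 : ℝ) ^ N - 1) * permMean g + m * (m - 1) / 2 := by
    simp only [permMean_add, Finset.sum_add_distrib, sum_ne_zeroBits_const]
    rw [← permMean_sum]
    gcongr
    refine (permMean_mono fun σ => ?_).trans_eq (permMean_const _)
    convert sum_collision_le _ (A.card_queriedUpTo_le u m σ)
  have h3 : permMean (fun σ : Equiv.Perm (Bits N) => if A.output u σ = false then (1 : ℝ) else 0) +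
      permMean g ≤ 1 + permMean (fun σ : Equiv.Perm (Bits N) =>
        if m < (A.queried u σ A.queries).card then 1 else 0) := by
    rw [← permMean_add]
    refine (permMean_mono (G := fun σ : Equiv.Perm (Bits N) =>
      1 + if m < (A.queried u σ A.queries).card then 1 else 0) fun σ => ?_).trans_eq
        (by rw [permMean_add, permMean_const])
    simp only [g, ← not_le]
    by_cases hq : (A.queried u σ A.queries).card ≤ m <;> cases A.output u σ <;> simp [hq]
  have h4 : (1 / 2) * (1 / ((2 : ℝ) ^ N - 1)) *
      (((2 : ℝ) ^ N - 1) * permMean g + m * (m - 1) / 2) =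
        1 / 2 * (permMean g + m * (m - 1) / 2 / ((2 : ℝ) ^ N - 1)) := by
    field_simp
  have h5 := h1.trans ((mul_le_mul_of_nonneg_left h2 (by positivity)).trans_eq h4)
  linarith

end ClassicalAlgorithm

/-! ### Entropy of the memory -/

/-- If all values that a variable takes on an event have at most `C` preimages, the entropy of the
variable is at least the probability of the event times `log (n! / C)`. -/
lemma permMean_mul_log_le_sum_negMulLog {X ι : Type*} [Fintype X] [DecidableEq X] [Fintype ι]
    [DecidableEq ι] (T : Equiv.Perm X → ι) (L : Equiv.Perm X → Prop) [DecidablePred L] {C : ℕ}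
    (hC : ∀ σ, L σ → (Finset.univ.filter fun τ => T τ = T σ).card ≤ C) :
    permMean (fun σ => if L σ then 1 else 0) *
        Real.log (Fintype.card (Equiv.Perm X) / C) ≤
      ∑ i, Real.negMulLog (permMean fun σ => if T σ = i then 1 else 0) := by
  have hpos : (0 : ℝ) < Fintype.card (Equiv.Perm X) := Nat.cast_pos.mpr Fintype.card_pos
  have hsplit : permMean (fun σ => if L σ then (1 : ℝ) else 0) =
      ∑ i, permMean fun σ => if L σ ∧ T σ = i then 1 else 0 := by
    rw [← permMean_sum]
    congr 1
    funext σ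
    by_cases h : L σ <;> simp [h]
  rw [hsplit, Finset.sum_mul]
  refine Finset.sum_le_sum fun i _ => ?_
  set P := permMean fun σ => if T σ = i then (1 : ℝ) else 0 with hP
  set P' := permMean fun σ => if L σ ∧ T σ = i then (1 : ℝ) else 0 with hP'
  have hP0 : 0 ≤ P := permMean_nonneg fun σ => by positivity
  have hP1 : P ≤ 1 := by
    rw [← permMean_const (X := X) 1]
    exact permMean_mono fun σ => by split_ifs <;> norm_num
  by_cases h : ∃ σ, L σ ∧ T σ = i
  · obtain ⟨σ, hσ, rfl⟩ := h
    have hPc : P = (Finset.univ.filter fun τ => T τ = T σ).card /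
        Fintype.card (Equiv.Perm X) := by
      simp only [hP, permMean, Finset.sum_boole]
    have hcard : 0 < (Finset.univ.filter fun τ => T τ = T σ).card :=
      Finset.card_pos.mpr ⟨σ, by simp⟩
    have hPpos : 0 < P := by rw [hPc]; positivity
    have hC0 : (0 : ℝ) < C := Nat.cast_pos.mpr (hcard.trans_le (hC σ hσ))
    have hle : P' ≤ P := permMean_mono fun τ => by
      by_cases h : T τ = T σ
      · rw [if_pos h]; split_ifs <;> norm_num
      · rw [if_neg h, if_neg fun h' => h h'.2]
    have hP'0 : 0 ≤ P' := permMean_nonneg fun σ => by positivity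
    have hlog : Real.log (Fintype.card (Equiv.Perm X) / C) ≤ -Real.log P := by
      rw [← Real.log_inv, hPc, inv_div]
      refine Real.log_le_log (by positivity) ?_
      gcongr
      exact hC σ hσ
    calc P' * Real.log (Fintype.card (Equiv.Perm X) / C) ≤ P' * -Real.log P := by gcongr
      _ ≤ P * -Real.log P := by
        have := Real.log_nonpos hP0 hP1
        gcongr
        linarith
      _ = Real.negMulLog P := by rw [Real.negMulLog]; ring
  · have : P' = 0 := by
      simp only [not_exists] at h
      simp only [hP', h, if_false, permMean_const]
    rw [this, zero_mul]
    exact Real.negMulLog_nonneg hP0 hP1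

namespace ClassicalAlgorithm

variable {N : ℕ} (A : ClassicalAlgorithm N)

lemma expect_eq (g : GateSequence A.width A.queries → Bool → (Bits N → Bits N) → ℝ) :
    A.expect g = ∑ u, A.weight u * ∑ b : Bool, ∑ s, ∑ f, simonWeight b s f * g u b f := by
  simp only [expect, Finset.mul_sum, mul_assoc]

lemma expect_const (hN : 0 < N) (c : ℝ) : A.expect (fun _ _ _ => c) = c := by
  simp only [expect_eq, ← Finset.sum_mul, sum_simonWeight hN]
  rw [A.weight_sum]
  simp

lemma expect_sum {ι : Type*} (t : Finset ι)
    (g : ι → GateSequence A.width A.queries → Bool → (Bits N → Bits N) → ℝ) :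
    A.expect (fun u b f => ∑ i ∈ t, g i u b f) = ∑ i ∈ t, A.expect (g i) := by
  simp only [expect, Finset.mul_sum]
  symm
  rw [Finset.sum_comm]
  refine Finset.sum_congr rfl fun u _ => ?_
  rw [Finset.sum_comm]
  refine Finset.sum_congr rfl fun b _ => ?_
  rw [Finset.sum_comm]
  refine Finset.sum_congr rfl fun s _ => ?_
  rw [Finset.sum_comm]

lemma jointProb_nonneg (a : Bool) (z : Bits A.width) : 0 ≤ A.jointProb a z := by
  refine Finset.sum_nonneg fun u _ => Finset.sum_nonneg fun b _ => Finset.sum_nonneg fun s _ =>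
    Finset.sum_nonneg fun f _ => mul_nonneg
      (mul_nonneg (A.weight_nonneg u) (simonWeight_nonneg b s f))
      (by dsimp only; split_ifs <;> norm_num)

lemma jointProb_le_outputProb (a : Bool) (z : Bits A.width) :
    A.jointProb a z ≤ A.outputProb a :=
  Finset.single_le_sum (fun z _ => A.jointProb_nonneg a z) (Finset.mem_univ z)

lemma outputProb_nonneg (a : Bool) : 0 ≤ A.outputProb a :=
  Finset.sum_nonneg fun z _ => A.jointProb_nonneg a z

lemma sum_jointProb_mul (g : Bool → Bits A.width → ℝ) :
    ∑ a, ∑ z, A.jointProb a z * g a z =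
      A.expect fun u _ f => g (A.output u f) (A.memAfterOutput u f) := by
  have h : ∀ u (b : Bool) f, g (A.output u f) (A.memAfterOutput u f) =
      ∑ p : Bool × Bits A.width, (if A.output u f = p.1 ∧ A.memAfterOutput u f = p.2
        then (1 : ℝ) else 0) * g p.1 p.2 := by
    intro u b f
    rw [Finset.sum_eq_single (A.output u f, A.memAfterOutput u f)]
    · simp
    · rintro ⟨a, z⟩ _ hne
      rw [if_neg, zero_mul]
      rintro ⟨rfl, rfl⟩
      exact hne rfl
    · simp
  rw [show (fun u (_ : Bool) f => g (A.output u f) (A.memAfterOutput u f)) = _ from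
    funext fun u => funext fun b => funext fun f => h u b f, expect_sum, Fintype.sum_prod_type]
  refine Finset.sum_congr rfl fun a _ => Finset.sum_congr rfl fun z _ => ?_
  simp only [jointProb, expect, Finset.sum_mul, mul_assoc]

lemma sum_outputProb (hN : 0 < N) : ∑ a, A.outputProb a = 1 := by
  have h := A.sum_jointProb_mul fun _ _ => 1
  simp only [mul_one] at h
  rw [A.expect_const hN] at h
  exact h

lemma condEntropy_nonneg : 0 ≤ A.condEntropy :=
  Finset.sum_nonneg fun a _ => mul_nonneg (A.outputProb_nonneg a) <| Finset.sum_nonneg fun z _ =>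
    Real.negMulLog_nonneg (div_nonneg (A.jointProb_nonneg a z) (A.outputProb_nonneg a))
      (div_le_one_of_le₀ (A.jointProb_le_outputProb a z) (A.outputProb_nonneg a))

/-- The chain rule `S(C|a) = S(C, a) - S(a)`. -/
lemma condEntropy_eq : A.condEntropy = (∑ a, ∑ z, Real.negMulLog (A.jointProb a z)) -
    ∑ a, Real.negMulLog (A.outputProb a) := by
  rw [condEntropy, ← Finset.sum_sub_distrib]
  refine Finset.sum_congr rfl fun a _ => ?_
  have h : ∀ z, A.outputProb a * Real.negMulLog (A.jointProb a z / A.outputProb a) =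
      Real.negMulLog (A.jointProb a z) + A.jointProb a z * Real.log (A.outputProb a) := by
    intro z
    rcases (A.jointProb_nonneg a z).eq_or_lt with hz | hz
    · simp [← hz]
    · have hp := hz.trans_le (A.jointProb_le_outputProb a z)
      rw [Real.negMulLog, Real.negMulLog, Real.log_div hz.ne' hp.ne']
      field_simp
      ring
  rw [Finset.mul_sum, Finset.sum_congr rfl fun z _ => h z, Finset.sum_add_distrib,
    ← Finset.sum_mul, ← outputProb, Real.negMulLog]
  ring

lemma sum_negMulLog_sub_log_two_le (hN : 0 < N) :
    (∑ a, ∑ z, Real.negMulLog (A.jointProb a z)) - Real.log 2 ≤ A.condEntropy := by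
  have h1 := A.sum_outputProb hN
  rw [Fintype.sum_bool] at h1
  have h2 : ∑ a, Real.negMulLog (A.outputProb a) ≤ Real.log 2 := by
    rw [Fintype.sum_bool, show A.outputProb false = 1 - A.outputProb true by linarith,
      ← Real.binEntropy_eq_negMulLog_add_negMulLog_one_sub]
    exact Real.binEntropy_le_log_two
  rw [A.condEntropy_eq]
  linarith

open Classical in
/-- Entropy is concave, so it can only drop when the operations and `b = 0` become known. -/
lemma sum_weight_mul_le_sum_negMulLog (hN : 0 < N) :
    1 / 2 * ∑ u, A.weight u * ∑ p : Bool × Bits A.width, Real.negMulLog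
      (permMean fun σ : Equiv.Perm (Bits N) =>
        if (A.output u σ, A.memAfterOutput u σ) = p then 1 else 0) ≤
      ∑ a, ∑ z, Real.negMulLog (A.jointProb a z) := by
  rw [← Fintype.sum_prod_type', Finset.mul_sum]
  simp only [Finset.mul_sum]
  rw [Finset.sum_comm]
  refine Finset.sum_le_sum fun p _ => ?_
  let F : GateSequence A.width A.queries → (Bits N → Bits N) → ℝ := fun u f =>
    if A.output u f = p.1 ∧ A.memAfterOutput u f = p.2 then 1 else 0
  let Q : GateSequence A.width A.queries × Bool → ℝ := fun i =>
    2 * ∑ s : Bits N, ∑ f, simonWeight i.2 s f * F i.1 f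
  have hF0 : ∀ u f, 0 ≤ F u f := fun u f => by simp only [F]; positivity
  have hF1 : ∀ u f, F u f ≤ 1 := fun u f => by simp only [F]; split_ifs <;> norm_num
  have hQ0 : ∀ i, 0 ≤ Q i := fun i => mul_nonneg zero_le_two <| Finset.sum_nonneg fun s _ =>
    Finset.sum_nonneg fun f _ => mul_nonneg (simonWeight_nonneg _ _ _) (hF0 _ _)
  have hQ1 : ∀ i, Q i ≤ 1 := by
    intro i
    have : ∑ s : Bits N, ∑ f, simonWeight i.2 s f * F i.1 f ≤ 1 / 2 := by
      rw [← sum_simonWeight hN i.2]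
      refine Finset.sum_le_sum fun s _ => Finset.sum_le_sum fun f _ => ?_
      exact mul_le_of_le_one_right (simonWeight_nonneg _ _ _) (hF1 _ _)
    simp only [Q]
    linarith
  have hJ : A.jointProb p.1 p.2 = ∑ i, (A.weight i.1 / 2) • Q i := by
    rw [jointProb, expect_eq, Fintype.sum_prod_type]
    refine Finset.sum_congr rfl fun u _ => ?_
    rw [Finset.mul_sum]
    refine Finset.sum_congr rfl fun b _ => ?_
    simp only [Q, F, smul_eq_mul]
    ring
  have hjensen := Real.concaveOn_negMulLog.le_map_sum (t := Finset.univ)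
    (w := fun i : GateSequence A.width A.queries × Bool => A.weight i.1 / 2) (p := Q)
    (fun i _ => div_nonneg (A.weight_nonneg _) zero_le_two)
    (by rw [Fintype.sum_prod_type]; simp only [Fintype.sum_bool, add_halves, A.weight_sum])
    (fun i _ => hQ0 i)
  rw [hJ]
  refine le_trans ?_ hjensen
  rw [Fintype.sum_prod_type]
  refine Finset.sum_le_sum fun u _ => ?_
  have hQf : Q (u, false) = permMean fun σ : Equiv.Perm (Bits N) =>
      if (A.output u σ, A.memAfterOutput u σ) = p then 1 else 0 := by
    simp only [Q]
    rw [sum_simonWeight_false hN]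
    simp only [F, Prod.ext_iff]
    ring
  rw [Fintype.sum_bool, hQf, smul_eq_mul, smul_eq_mul]
  have := mul_nonneg (div_nonneg (A.weight_nonneg u) zero_le_two)
    (Real.negMulLog_nonneg (hQ0 (u, true)) (hQ1 (u, true)))
  linarith

/-- A run that evaluates `f` at more than `m` points leaves in the memory a record of more than `m`
values of a random permutation, and such runs have probability at least `1/3` minus the
probability of a collision among `m` points. -/
lemma SolvesSimon.entropy_ge {A : ClassicalAlgorithm N} (hA : A.SolvesSimon) (hN : 0 < N) (m : ℕ) :
    1 / 2 * (1 / 3 - m * (m - 1) / 2 / ((2 : ℝ) ^ N - 1)) *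
      Real.log ((2 ^ N).factorial / (2 ^ N - (m + 1)).factorial) - Real.log 2 ≤
        A.condEntropy := by
  refine le_trans (sub_le_sub_right ?_ _) (A.sum_negMulLog_sub_log_two_le hN)
  refine le_trans ?_ (A.sum_weight_mul_le_sum_negMulLog hN)
  set δ : ℝ := m * (m - 1) / 2 / ((2 : ℝ) ^ N - 1)
  set ℓ := Real.log ((2 ^ N).factorial / (2 ^ N - (m + 1)).factorial : ℝ)
  let q : GateSequence A.width A.queries → ℝ := fun u =>
    permMean fun σ : Equiv.Perm (Bits N) => if m < (A.queried u σ A.queries).card then 1 else 0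
  have hℓ : 0 ≤ ℓ := by
    refine Real.log_nonneg ((one_le_div (by positivity)).mpr ?_)
    exact_mod_cast Nat.factorial_le (Nat.sub_le _ _)
  have hq : 1 / 3 - δ ≤ ∑ u, A.weight u * q u := by
    have h : A.successProb ≤ ∑ u, A.weight u * (1 / 2 * (1 + q u + δ)) := by
      rw [successProb, expect_eq]
      exact Finset.sum_le_sum fun u _ => mul_le_mul_of_nonneg_left
        (A.sum_output_eq_le u hN m) (A.weight_nonneg u)
    have e : ∑ u, A.weight u * (1 / 2 * (1 + q u + δ)) =
        1 / 2 * (1 + δ) + 1 / 2 * ∑ u, A.weight u * q u := by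
      rw [← one_mul (1 / 2 * (1 + δ)), ← A.weight_sum, Finset.sum_mul, Finset.mul_sum,
        ← Finset.sum_add_distrib]
      exact Finset.sum_congr rfl fun u _ => by ring
    have := hA.2
    linarith
  have hu : ∀ u, A.weight u * (q u * ℓ) ≤ A.weight u * ∑ p : Bool × Bits A.width,
      Real.negMulLog (permMean fun σ : Equiv.Perm (Bits N) =>
        if (A.output u σ, A.memAfterOutput u σ) = p then 1 else 0) := by
    intro u
    rcases eq_or_ne (A.weight u) 0 with hw | hw
    · simp [hw]
    refine mul_le_mul_of_nonneg_left ?_ (A.weight_nonneg u)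
    have hclean : ∀ σ : Equiv.Perm (Bits N), A.CleanRun u σ := fun σ =>
      hA.1 u hw false (fun _ => true) σ (fun h => by simpa [zeroBits] using congrFun h ⟨0, hN⟩)
        σ.injective
    have h := permMean_mul_log_le_sum_negMulLog (C := (2 ^ N - (m + 1)).factorial)
      (fun σ : Equiv.Perm (Bits N) => (A.output u σ, A.memAfterOutput u σ))
      (fun σ => m < (A.queried u σ A.queries).card) ?_
    · rw [Fintype.card_perm, card_bits] at h
      exact h
    intro σ hσ
    rw [← card_bits (N := N)]
    refine le_trans (Finset.card_le_card fun τ hτ => ?_) (card_perm_eqOn_le σ hσ)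
    simp only [Finset.mem_filter, Finset.mem_univ, true_and, Prod.mk.injEq] at hτ ⊢
    exact A.eq_on_queried_of_output_eq u (hclean σ) (hclean τ) hτ.1.symm hτ.2.symm
  calc 1 / 2 * (1 / 3 - δ) * ℓ ≤ 1 / 2 * (∑ u, A.weight u * q u) * ℓ := by gcongr
    _ = 1 / 2 * ∑ u, A.weight u * (q u * ℓ) := by
      rw [mul_assoc, Finset.sum_mul]
      simp only [mul_assoc]
    _ ≤ _ := mul_le_mul_of_nonneg_left (Finset.sum_le_sum fun u _ => hu u) (by norm_num)

end ClassicalAlgorithm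

/-! ### Thermal states and bipartite matrices -/

/-- The block of a matrix on memory and bath that belongs to the memory states `z` and `z'`. -/
def bathBlock {W d : ℕ} (ρ : Matrix (Bits W × Fin d) (Bits W × Fin d) ℂ) (z z' : Bits W) :
    Matrix (Fin d) (Fin d) ℂ := fun e e' => ρ (z, e) (z', e')

lemma traceBath_apply {W d : ℕ} (ρ : Matrix (Bits W × Fin d) (Bits W × Fin d) ℂ) (z z' : Bits W) :
    traceBath ρ z z' = (bathBlock ρ z z').trace := rfl

lemma traceMem_eq {W d : ℕ} (ρ : Matrix (Bits W × Fin d) (Bits W × Fin d) ℂ) :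
    traceMem ρ = ∑ z, bathBlock ρ z z := by
  ext e e'
  simp [traceMem, bathBlock, Matrix.sum_apply]

lemma bathBlock_conj {W d : ℕ} (A B : Matrix (Fin d) (Fin d) ℂ)
    (R : Matrix (Bits W × Fin d) (Bits W × Fin d) ℂ) (z z' : Bits W) :
    bathBlock ((1 ⊗ₖ A) * R * (1 ⊗ₖ B)) z z' = A * bathBlock R z z' * B := by
  ext e e'
  simp only [bathBlock, Matrix.mul_apply, Fintype.sum_prod_type, Matrix.kroneckerMap_apply,
    Matrix.one_apply, ite_mul, one_mul, zero_mul, mul_ite, mul_zero]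
  simp [Finset.sum_ite_eq]

lemma isHermitian_eq_conj {d : ℕ} {H : Matrix (Fin d) (Fin d) ℂ} (hH : H.IsHermitian) :
    H = (hH.eigenvectorUnitary : Matrix (Fin d) (Fin d) ℂ) *
      Matrix.diagonal (fun i => (hH.eigenvalues i : ℂ)) *
      (hH.eigenvectorUnitary : Matrix (Fin d) (Fin d) ℂ).conjTranspose :=
  hH.spectral_theorem

/-- The Boltzmann weights of the energies `E`, normalized. -/
def boltzmann {d : ℕ} (β : ℝ) (E : Fin d → ℝ) (e : Fin d) : ℝ :=
  (∑ i, Real.exp (-β * E i))⁻¹ * Real.exp (-β * E e)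

lemma partition_pos {d : ℕ} (hd : 0 < d) (β : ℝ) (E : Fin d → ℝ) :
    0 < ∑ i, Real.exp (-β * E i) := by
  have : Nonempty (Fin d) := ⟨⟨0, hd⟩⟩
  exact Finset.sum_pos (fun i _ => Real.exp_pos _) Finset.univ_nonempty

lemma boltzmann_pos {d : ℕ} (β : ℝ) (E : Fin d → ℝ) (e : Fin d) : 0 < boltzmann β E e :=
  mul_pos (inv_pos.mpr (partition_pos e.pos β E)) (Real.exp_pos _)

lemma sum_boltzmann {d : ℕ} (hd : 0 < d) (β : ℝ) (E : Fin d → ℝ) :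
    ∑ e, boltzmann β E e = 1 := by
  simp only [boltzmann, ← Finset.mul_sum]
  exact inv_mul_cancel₀ (partition_pos hd β E).ne'

lemma log_boltzmann {d : ℕ} (β : ℝ) (E : Fin d → ℝ) (e : Fin d) :
    Real.log (boltzmann β E e) = -β * E e - Real.log (∑ i, Real.exp (-β * E i)) := by
  rw [boltzmann, Real.log_mul (inv_pos.mpr (partition_pos e.pos β E)).ne' (Real.exp_pos _).ne',
    Real.log_inv, Real.log_exp]
  ring

lemma gibbs_eq_conj {d : ℕ} (β : ℝ) {H : Matrix (Fin d) (Fin d) ℂ} (hH : H.IsHermitian) :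
    gibbs β H = (hH.eigenvectorUnitary : Matrix (Fin d) (Fin d) ℂ) *
      Matrix.diagonal (fun i => (boltzmann β hH.eigenvalues i : ℂ)) *
      (hH.eigenvectorUnitary : Matrix (Fin d) (Fin d) ℂ).conjTranspose := by
  set V := hH.eigenvectorUnitary
  have hVV : (V : Matrix (Fin d) (Fin d) ℂ).conjTranspose * V = 1 := Unitary.coe_star_mul_self V
  have hexp : NormedSpace.exp (-(β : ℂ) • H) = (V : Matrix (Fin d) (Fin d) ℂ) *
      Matrix.diagonal (fun i => (Real.exp (-β * hH.eigenvalues i) : ℂ)) *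
      (V : Matrix (Fin d) (Fin d) ℂ).conjTranspose := by
    have h := Matrix.exp_units_conj (Unitary.toUnits V)
      (Matrix.diagonal fun i => (-(β : ℂ) * hH.eigenvalues i : ℂ))
    rw [Matrix.exp_diagonal] at h
    convert h using 2
    · conv_lhs => rw [isHermitian_eq_conj hH]
      rw [← Matrix.smul_mul, ← Matrix.mul_smul, ← Matrix.diagonal_smul]
      rfl
    · congr 2
      funext i
      rw [Pi.coe_exp, ← Complex.exp_eq_exp_ℂ]
      simp
    · rfl
  have htr : (NormedSpace.exp (-(β : ℂ) • H)).trace =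
      ((∑ i, Real.exp (-β * hH.eigenvalues i) : ℝ) : ℂ) := by
    rw [hexp, Matrix.trace_mul_comm, ← mul_assoc, hVV, one_mul, Matrix.trace_diagonal]
    push_cast
    rfl
  rw [gibbs, htr, hexp, ← Matrix.smul_mul, ← Matrix.mul_smul, ← Matrix.diagonal_smul]
  congr 3
  funext i
  simp [boltzmann]

/-! ### A second law for unitary evolutions -/

lemma sum_normSq_col {I : Type*} [Fintype I] [DecidableEq I] (M : Matrix.unitaryGroup I ℂ)
    (j : I) : ∑ i, Complex.normSq (M.1 i j) = 1 := by
  have h := congrFun (congrFun (Unitary.coe_star_mul_self M) j) j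
  rw [Matrix.mul_apply, Matrix.one_apply_eq] at h
  simpa [Matrix.star_apply, Complex.normSq_apply] using congrArg Complex.re h

/-- Klein's inequality for the diagonal `q` of `M diag(p) M†`, where `M` is unitary: the matrix of
the `|M i j|²` is doubly stochastic, so the scalar inequality `p log p - p log r ≥ p - r` can be
summed up against it. -/
lemma sum_mul_log_diag_conj_le {I : Type*} [Fintype I] [DecidableEq I]
    (M : Matrix.unitaryGroup I ℂ) {p r : I → ℝ} (hp : ∀ i, 0 ≤ p i) (hr : ∀ i, 0 < r i)
    (hsum : ∑ i, p i = ∑ i, r i) :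
    ∑ i, (∑ j, Complex.normSq (M.1 i j) * p j) * Real.log (r i) ≤ ∑ j, p j * Real.log (p j) := by
  have hcol := sum_normSq_col M
  have hrow : ∀ i, ∑ j, Complex.normSq (M.1 i j) = 1 := by
    intro i
    have h := sum_normSq_col (star M) i
    simpa [Matrix.star_apply, Complex.normSq_conj] using h
  have hscalar : ∀ i j, p j - r i ≤ p j * Real.log (p j) - p j * Real.log (r i) := by
    intro i j
    rcases (hp j).eq_or_lt with h | h
    · simp [← h, (hr i).le]
    · have := Real.log_le_sub_one_of_pos (div_pos (hr i) h)
      rw [Real.log_div (hr i).ne' h.ne'] at this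
      have h2 := mul_le_mul_of_nonneg_left this h.le
      rw [mul_sub, mul_sub, mul_div_cancel₀ _ h.ne'] at h2
      linarith
  have hA : ∑ i, ∑ j, Complex.normSq (M.1 i j) * p j = ∑ j, p j := by
    rw [Finset.sum_comm]
    simp only [← Finset.sum_mul, hcol, one_mul]
  have hB : ∑ i, ∑ j, Complex.normSq (M.1 i j) * r i = ∑ i, r i := by
    simp only [← Finset.sum_mul, hrow, one_mul]
  have hC : ∑ i, ∑ j, Complex.normSq (M.1 i j) * (p j * Real.log (p j)) =
      ∑ j, p j * Real.log (p j) := by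
    rw [Finset.sum_comm]
    simp only [← Finset.sum_mul, hcol, one_mul]
  have key : ∑ i, ∑ j, Complex.normSq (M.1 i j) * (p j - r i) ≤
      ∑ i, ∑ j, Complex.normSq (M.1 i j) * (p j * Real.log (p j) - p j * Real.log (r i)) :=
    Finset.sum_le_sum fun i _ => Finset.sum_le_sum fun j _ =>
      mul_le_mul_of_nonneg_left (hscalar i j) (Complex.normSq_nonneg _)
  simp only [mul_sub, Finset.sum_sub_distrib, hA, hB, hC, hsum, sub_self] at key
  simp only [Finset.sum_mul, mul_assoc]
  linarith

lemma diag_conj_diagonal {I : Type*} [Fintype I] [DecidableEq I] (M : Matrix I I ℂ) (p : I → ℝ)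
    (i : I) : (M * Matrix.diagonal (fun j => (p j : ℂ)) * M.conjTranspose) i i =
      ((∑ j, Complex.normSq (M i j) * p j : ℝ) : ℂ) := by
  rw [Matrix.mul_apply]
  push_cast
  refine Finset.sum_congr rfl fun j _ => ?_
  rw [Matrix.mul_diagonal, Matrix.conjTranspose_apply, mul_right_comm, RCLike.star_def,
    Complex.mul_conj]

namespace ClassicalAlgorithm

variable {N : ℕ} (A : ClassicalAlgorithm N)

/-- The unitary of the erasure, in the basis of eigenvectors of the Hamiltonian of the bath. -/
def eigenGate (P : ErasureProtocol A.width) (a : Bool) :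
    Matrix.unitaryGroup (Bits A.width × Fin P.dim) ℂ :=
  let V : Matrix.unitaryGroup (Bits A.width × Fin P.dim) ℂ :=
    ⟨1 ⊗ₖ (P.ham_isHermitian.eigenvectorUnitary : Matrix (Fin P.dim) (Fin P.dim) ℂ),
      Matrix.kronecker_mem_unitary (one_mem _) P.ham_isHermitian.eigenvectorUnitary.2⟩
  star V * P.gate a * V

/-- The joint probability of the output `a`, the memory state `z`, and the energy level `e` of the
bath before the erasure. -/
def priorProb (β : ℝ) (P : ErasureProtocol A.width) (a : Bool)
    (i : Bits A.width × Fin P.dim) : ℝ :=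
  A.jointProb a i.1 * boltzmann β P.ham_isHermitian.eigenvalues i.2

/-- The joint probability of the output `a`, the memory state `z`, and the energy level `e` of the
bath after the erasure: the diagonal of the final state in the basis of eigenvectors. -/
def posteriorProb (β : ℝ) (P : ErasureProtocol A.width) (a : Bool)
    (i : Bits A.width × Fin P.dim) : ℝ :=
  ∑ j, Complex.normSq ((A.eigenGate P a).1 i j) * A.priorProb β P a j

lemma jointStateAfter_eq (β : ℝ) (P : ErasureProtocol A.width) :
    A.jointStateAfter β P =
      (1 ⊗ₖ (P.ham_isHermitian.eigenvectorUnitary : Matrix (Fin P.dim) (Fin P.dim) ℂ)) *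
      (∑ a, (A.eigenGate P a).1 * Matrix.diagonal (fun i => (A.priorProb β P a i : ℂ)) *
        (A.eigenGate P a).1.conjTranspose) *
      (1 ⊗ₖ (P.ham_isHermitian.eigenvectorUnitary :
        Matrix (Fin P.dim) (Fin P.dim) ℂ).conjTranspose) := by
  set V : Matrix (Fin P.dim) (Fin P.dim) ℂ :=
    (P.ham_isHermitian.eigenvectorUnitary : Matrix (Fin P.dim) (Fin P.dim) ℂ) with hV
  have hVV : V * V.conjTranspose = 1 := Unitary.coe_mul_star_self _
  have hKK : ((1 : Matrix (Bits A.width) (Bits A.width) ℂ) ⊗ₖ V) * (1 ⊗ₖ V.conjTranspose) = 1 := by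
    rw [← Matrix.mul_kronecker_mul, hVV, one_mul, Matrix.one_kronecker_one]
  have hstar : ((1 : Matrix (Bits A.width) (Bits A.width) ℂ) ⊗ₖ V).conjTranspose =
      1 ⊗ₖ V.conjTranspose := by
    rw [Matrix.conjTranspose_kronecker, Matrix.conjTranspose_one]
  rw [jointStateAfter, Finset.mul_sum, Finset.sum_mul]
  refine Finset.sum_congr rfl fun a _ => ?_
  have hg : (A.eigenGate P a).1 = (1 ⊗ₖ V.conjTranspose) * (P.gate a).1 * (1 ⊗ₖ V) := by
    rw [← hstar]
    rfl
  have hstate : A.subState a ⊗ₖ gibbs β P.ham = (1 ⊗ₖ V) *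
      Matrix.diagonal (fun i => (A.priorProb β P a i : ℂ)) * (1 ⊗ₖ V.conjTranspose) := by
    have hd : Matrix.diagonal (fun i => (A.priorProb β P a i : ℂ)) = A.subState a ⊗ₖ
        Matrix.diagonal fun e => (boltzmann β P.ham_isHermitian.eigenvalues e : ℂ) := by
      rw [subState, Matrix.diagonal_kronecker_diagonal]
      simp only [priorProb, Complex.ofReal_mul]
    rw [hd, ← Matrix.mul_kronecker_mul, ← Matrix.mul_kronecker_mul, one_mul, mul_one,
      gibbs_eq_conj β P.ham_isHermitian]
  rw [hstate, hg, Matrix.conjTranspose_mul, Matrix.conjTranspose_mul, hstar, ← hstar,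
    Matrix.conjTranspose_conjTranspose, hstar]
  set K : Matrix (Bits A.width × Fin P.dim) (Bits A.width × Fin P.dim) ℂ := 1 ⊗ₖ V
  set K' : Matrix (Bits A.width × Fin P.dim) (Bits A.width × Fin P.dim) ℂ := 1 ⊗ₖ V.conjTranspose
  set D := Matrix.diagonal fun i => (A.priorProb β P a i : ℂ)
  calc (P.gate a).1 * (K * D * K') * (P.gate a).1.conjTranspose
      = 1 * (P.gate a).1 * K * D * K' * (P.gate a).1.conjTranspose * 1 := by
        simp only [one_mul, mul_one, mul_assoc]
    _ = _ := by
        rw [← hKK]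
        simp only [mul_assoc]

lemma diag_eigen_eq (β : ℝ) (P : ErasureProtocol A.width) (i : Bits A.width × Fin P.dim) :
    (∑ a, (A.eigenGate P a).1 * Matrix.diagonal (fun i => (A.priorProb β P a i : ℂ)) *
        (A.eigenGate P a).1.conjTranspose) i i = ((∑ a, A.posteriorProb β P a i : ℝ) : ℂ) := by
  rw [Matrix.sum_apply]
  push_cast
  exact Finset.sum_congr rfl fun a _ => diag_conj_diagonal _ _ _

lemma stateAfter_diag (β : ℝ) (P : ErasureProtocol A.width) (z : Bits A.width) :
    A.stateAfter β P z z = ((∑ e, ∑ a, A.posteriorProb β P a (z, e) : ℝ) : ℂ) := by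
  rw [stateAfter, traceBath_apply, jointStateAfter_eq, bathBlock_conj, Matrix.trace_mul_comm,
    ← mul_assoc, ← Matrix.star_eq_conjTranspose,
    Unitary.coe_star_mul_self, one_mul, Matrix.trace,
    Complex.ofReal_sum]
  exact Finset.sum_congr rfl fun e _ => A.diag_eigen_eq β P (z, e)

lemma bathHeat_eq (β : ℝ) (P : ErasureProtocol A.width) :
    A.bathHeat β P = (∑ z, ∑ e, P.ham_isHermitian.eigenvalues e *
      ∑ a, A.posteriorProb β P a (z, e)) - ∑ e, P.ham_isHermitian.eigenvalues e *
        boltzmann β P.ham_isHermitian.eigenvalues e := by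
  set E := P.ham_isHermitian.eigenvalues with hE
  set V : Matrix (Fin P.dim) (Fin P.dim) ℂ :=
    (P.ham_isHermitian.eigenvectorUnitary : Matrix (Fin P.dim) (Fin P.dim) ℂ) with hV
  have hVV : V.conjTranspose * V = 1 := Unitary.coe_star_mul_self _
  have hconj : ∀ B : Matrix (Fin P.dim) (Fin P.dim) ℂ,
      (P.ham * (V * B * V.conjTranspose)).trace = ∑ e, (E e : ℂ) * B e e := by
    intro B
    have h : P.ham * (V * B * V.conjTranspose) =
        V * (Matrix.diagonal (fun i => (E i : ℂ)) * B * V.conjTranspose) := by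
      conv_lhs => rw [isHermitian_eq_conj P.ham_isHermitian]
      rw [← hV, ← hE]
      calc _ = V * Matrix.diagonal (fun i => (E i : ℂ)) * (V.conjTranspose * V) * B *
            V.conjTranspose := by simp only [mul_assoc]
        _ = _ := by rw [hVV]; simp only [mul_assoc, one_mul]
    rw [h, Matrix.trace_mul_comm, mul_assoc, hVV, mul_one, Matrix.trace]
    exact Finset.sum_congr rfl fun e _ => by rw [Matrix.diag_apply, Matrix.diagonal_mul]
  rw [bathHeat, mul_sub, Matrix.trace_sub, Complex.sub_re, gibbs_eq_conj β P.ham_isHermitian,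
    hconj, traceMem_eq, Finset.mul_sum, Matrix.trace_sum]
  congr 1
  · rw [Complex.re_sum]
    refine Finset.sum_congr rfl fun z _ => ?_
    rw [jointStateAfter_eq, bathBlock_conj, hconj, Complex.re_sum]
    refine Finset.sum_congr rfl fun e _ => ?_
    rw [bathBlock, diag_eigen_eq, Complex.re_ofReal_mul, Complex.ofReal_re]
  · rw [Complex.re_sum]
    refine Finset.sum_congr rfl fun e _ => ?_
    rw [Matrix.diagonal_apply_eq, Complex.re_ofReal_mul, Complex.ofReal_re]

end ClassicalAlgorithm

/-! ### Landauer's principle -/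

/-- The distribution of independent bits that are `1` with probability `η`. -/
def bernoulliProd {W : ℕ} (η : ℝ) (z : Bits W) : ℝ := ∏ w, if z w then η else 1 - η

lemma bernoulliProd_pos {W : ℕ} {η : ℝ} (h0 : 0 < η) (h1 : η < 1) (z : Bits W) :
    0 < bernoulliProd η z :=
  Finset.prod_pos fun w _ => by split_ifs <;> linarith

lemma sum_bernoulliProd {W : ℕ} (η : ℝ) : ∑ z : Bits W, bernoulliProd η z = 1 := by
  have h := Finset.prod_univ_sum (fun _ : Fin W => (Finset.univ : Finset Bool))
    fun _ b => if b = true then η else 1 - η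
  rw [Fintype.piFinset_univ] at h
  simp only [bernoulliProd]
  rw [← h]
  simp

lemma log_bernoulliProd {W : ℕ} {η : ℝ} (h0 : 0 < η) (h1 : η < 1) (z : Bits W) :
    Real.log (bernoulliProd η z) =
      ∑ w, (Real.log η + if z w = false then Real.log (1 - η) - Real.log η else 0) := by
  rw [bernoulliProd, Real.log_prod fun w _ => by split_ifs <;> linarith]
  refine Finset.sum_congr rfl fun w _ => ?_
  cases z w <;> simp

lemma memEnergy_eq {W : ℕ} (level : Fin W → Bool → ℝ) (z : Bits W) :
    memEnergy level z =
      ∑ w, (level w true + if z w = false then level w false - level w true else 0) := by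
  refine Finset.sum_congr rfl fun w _ => ?_
  cases z w <;> simp

namespace ClassicalAlgorithm

variable {N : ℕ} (A : ClassicalAlgorithm N)

lemma expect_add (g h : GateSequence A.width A.queries → Bool → (Bits N → Bits N) → ℝ) :
    A.expect (fun u b f => g u b f + h u b f) = A.expect g + A.expect h := by
  simp only [expect, mul_add, Finset.sum_add_distrib]

lemma expect_sub (g h : GateSequence A.width A.queries → Bool → (Bits N → Bits N) → ℝ) :
    A.expect (fun u b f => g u b f - h u b f) = A.expect g - A.expect h := by
  simp only [expect, mul_sub, Finset.sum_sub_distrib]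

lemma priorProb_nonneg (β : ℝ) (P : ErasureProtocol A.width) (a : Bool)
    (i : Bits A.width × Fin P.dim) : 0 ≤ A.priorProb β P a i :=
  mul_nonneg (A.jointProb_nonneg a i.1) (boltzmann_pos β _ _).le

lemma posteriorProb_nonneg (β : ℝ) (P : ErasureProtocol A.width) (a : Bool)
    (i : Bits A.width × Fin P.dim) : 0 ≤ A.posteriorProb β P a i :=
  Finset.sum_nonneg fun j _ => mul_nonneg (Complex.normSq_nonneg _) (A.priorProb_nonneg β P a j)

lemma sum_priorProb (β : ℝ) (P : ErasureProtocol A.width) (a : Bool) :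
    ∑ i, A.priorProb β P a i = A.outputProb a := by
  simp only [priorProb, Fintype.sum_prod_type, ← Finset.mul_sum, sum_boltzmann P.dim_pos, mul_one,
    outputProb]

lemma sum_posteriorProb (β : ℝ) (P : ErasureProtocol A.width) (a : Bool) :
    ∑ i, A.posteriorProb β P a i = A.outputProb a := by
  simp only [posteriorProb]
  rw [Finset.sum_comm]
  simp only [← Finset.sum_mul, sum_normSq_col, one_mul, sum_priorProb]

/-- The distribution of the memory after the erasure. -/
def memProb (β : ℝ) (P : ErasureProtocol A.width) (z : Bits A.width) : ℝ :=
  ∑ e, ∑ a, A.posteriorProb β P a (z, e)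

lemma memProb_nonneg (β : ℝ) (P : ErasureProtocol A.width) (z : Bits A.width) :
    0 ≤ A.memProb β P z :=
  Finset.sum_nonneg fun _ _ => Finset.sum_nonneg fun _ _ => A.posteriorProb_nonneg β P _ _

lemma sum_memProb (hN : 0 < N) (β : ℝ) (P : ErasureProtocol A.width) :
    ∑ z, A.memProb β P z = 1 := by
  rw [← A.sum_outputProb hN]
  simp only [memProb, ← sum_posteriorProb A β P]
  rw [← Fintype.sum_prod_type', Finset.sum_comm]

lemma fidelity_eq (β : ℝ) (P : ErasureProtocol A.width) (w : Fin A.width) :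
    A.fidelity β P w = ∑ z, if z w = false then A.memProb β P z else 0 := by
  simp only [fidelity, stateAfter_diag, Complex.ofReal_re, memProb]

lemma fidelity_le_one (hN : 0 < N) (β : ℝ) (P : ErasureProtocol A.width) (w : Fin A.width) :
    A.fidelity β P w ≤ 1 := by
  rw [fidelity_eq, ← A.sum_memProb hN β P]
  refine Finset.sum_le_sum fun z _ => ?_
  split_ifs
  · exact le_rfl
  · exact A.memProb_nonneg β P z

/-- Expectations of sums of one-bit quantities depend only on the fidelities of the bits. -/
lemma sum_memProb_mul (hN : 0 < N) (β : ℝ) (P : ErasureProtocol A.width)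
    (c d : Fin A.width → ℝ) :
    ∑ z, A.memProb β P z * ∑ w, (c w + if z w = false then d w else 0) =
      ∑ w, (c w + A.fidelity β P w * d w) := by
  simp only [Finset.mul_sum]
  rw [Finset.sum_comm]
  refine Finset.sum_congr rfl fun w _ => ?_
  simp only [mul_add, Finset.sum_add_distrib, ← Finset.sum_mul, A.sum_memProb hN, one_mul]
  congr 1
  rw [fidelity_eq, Finset.sum_mul]
  exact Finset.sum_congr rfl fun z _ => by split_ifs <;> simp

/-- Klein's inequality relative to the product of `bernoulliProd η` with the Gibbs state of the
bath, summed over the outputs. -/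
lemma condEntropy_add_le_bathHeat (hN : 0 < N) (β : ℝ) (P : ErasureProtocol A.width) {η : ℝ}
    (h0 : 0 < η) (h1 : η < 1) :
    A.condEntropy + ∑ z, A.memProb β P z * Real.log (bernoulliProd η z) ≤
      β * A.bathHeat β P := by
  set E := P.ham_isHermitian.eigenvalues with hE
  set g := boltzmann β E with hg
  have hr := bernoulliProd_pos (W := A.width) h0 h1
  have hgpos : ∀ e, 0 < g e := boltzmann_pos β E
  have hkey : ∀ a, ∑ i, A.posteriorProb β P a i *
      (Real.log (A.outputProb a) + (Real.log (bernoulliProd η i.1) + Real.log (g i.2))) ≤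
        ∑ i : Bits A.width × Fin P.dim, A.jointProb a i.1 * g i.2 *
          (Real.log (A.jointProb a i.1) + Real.log (g i.2)) := by
    intro a
    -- For an output of probability `0` there is no reference state, but both sides vanish.
    rcases (A.outputProb_nonneg a).eq_or_lt with hp | hp
    · have hJ : ∀ z, A.jointProb a z = 0 := fun z =>
        le_antisymm ((A.jointProb_le_outputProb a z).trans_eq hp.symm) (A.jointProb_nonneg a z)
      simp [posteriorProb, priorProb, hJ]
    · have h := sum_mul_log_diag_conj_le (A.eigenGate P a) (p := A.priorProb β P a)
        (r := fun i => A.outputProb a * (bernoulliProd η i.1 * g i.2))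
        (A.priorProb_nonneg β P a) (fun i => mul_pos hp (mul_pos (hr _) (hgpos _))) (by
          rw [sum_priorProb, ← Finset.mul_sum, Fintype.sum_prod_type]
          simp only [← Finset.mul_sum, hg, sum_boltzmann P.dim_pos, mul_one, sum_bernoulliProd])
      refine le_trans (le_of_eq ?_) (h.trans_eq ?_)
      · refine Finset.sum_congr rfl fun i _ => ?_
        rw [Real.log_mul hp.ne' (mul_pos (hr _) (hgpos _)).ne',
          Real.log_mul (hr _).ne' (hgpos _).ne']
        rfl
      · refine Finset.sum_congr rfl fun i _ => ?_
        simp only [priorProb, ← hE, ← hg]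
        rcases (A.jointProb_nonneg a i.1).eq_or_lt with hz | hz
        · simp [← hz]
        · rw [Real.log_mul hz.ne' (hgpos _).ne']
  have hsum := Finset.sum_le_sum fun (a : Bool) (_ : a ∈ Finset.univ) => hkey a
  have hR : ∑ a, ∑ i : Bits A.width × Fin P.dim, A.jointProb a i.1 * g i.2 *
      (Real.log (A.jointProb a i.1) + Real.log (g i.2)) =
        -(∑ a, ∑ z, Real.negMulLog (A.jointProb a z)) + ∑ e, g e * Real.log (g e) := by
    have h : ∀ a, ∑ i : Bits A.width × Fin P.dim, A.jointProb a i.1 * g i.2 *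
        (Real.log (A.jointProb a i.1) + Real.log (g i.2)) =
          -(∑ z, Real.negMulLog (A.jointProb a z)) +
            A.outputProb a * ∑ e, g e * Real.log (g e) := by
      intro a
      rw [Fintype.sum_prod_type, outputProb, Finset.sum_mul, ← Finset.sum_neg_distrib,
        ← Finset.sum_add_distrib]
      refine Finset.sum_congr rfl fun z _ => ?_
      calc ∑ e, A.jointProb a z * g e * (Real.log (A.jointProb a z) + Real.log (g e))
          = A.jointProb a z * Real.log (A.jointProb a z) * ∑ e, g e +
              A.jointProb a z * ∑ e, g e * Real.log (g e) := by
            rw [Finset.mul_sum, Finset.mul_sum, ← Finset.sum_add_distrib]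
            exact Finset.sum_congr rfl fun e _ => by ring
        _ = _ := by
            rw [hg, sum_boltzmann P.dim_pos, Real.negMulLog]
            ring
    rw [Finset.sum_congr rfl fun a _ => h a, Finset.sum_add_distrib, Finset.sum_neg_distrib,
      ← Finset.sum_mul, A.sum_outputProb hN, one_mul]
  have hL : ∑ a, ∑ i, A.posteriorProb β P a i *
      (Real.log (A.outputProb a) + (Real.log (bernoulliProd η i.1) + Real.log (g i.2))) =
        -(∑ a, Real.negMulLog (A.outputProb a)) +
          (∑ z, A.memProb β P z * Real.log (bernoulliProd η z) +
            ∑ z, ∑ e, (∑ a, A.posteriorProb β P a (z, e)) * Real.log (g e)) := by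
    simp only [mul_add, Finset.sum_add_distrib, ← Finset.sum_mul, sum_posteriorProb]
    congr 1
    · rw [← Finset.sum_neg_distrib]
      exact Finset.sum_congr rfl fun a _ => by rw [Real.negMulLog]; ring
    · congr 1
      · rw [Finset.sum_comm, Fintype.sum_prod_type]
        simp only [memProb, Finset.sum_mul]
      · rw [Finset.sum_comm, Fintype.sum_prod_type]
        simp only [Finset.sum_mul]
  set ℓ := Real.log (∑ i, Real.exp (-β * E i)) with hℓ
  have hq1 : ∑ z, ∑ e, ∑ a, A.posteriorProb β P a (z, e) = 1 := A.sum_memProb hN β P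
  have hQ : ∑ z, ∑ e, (∑ a, A.posteriorProb β P a (z, e)) * Real.log (g e) =
      -β * (∑ z, ∑ e, E e * ∑ a, A.posteriorProb β P a (z, e)) - ℓ := by
    rw [← one_mul ℓ, ← hq1]
    simp only [Finset.mul_sum, Finset.sum_mul, ← Finset.sum_sub_distrib]
    refine Finset.sum_congr rfl fun z _ => Finset.sum_congr rfl fun e _ =>
      Finset.sum_congr rfl fun a _ => ?_
    rw [hg, log_boltzmann]
    ring
  have hG : ∑ e, g e * Real.log (g e) = -β * (∑ e, E e * g e) - ℓ := by
    rw [← one_mul ℓ, ← sum_boltzmann P.dim_pos β E]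
    simp only [Finset.mul_sum, Finset.sum_mul, ← Finset.sum_sub_distrib]
    refine Finset.sum_congr rfl fun e _ => ?_
    rw [hg, log_boltzmann]
    ring
  rw [hR, hL, hQ, hG] at hsum
  rw [condEntropy_eq, bathHeat_eq, ← hE, ← hg]
  linarith

/-! ### The energy balance of the cycle -/

variable (level : Fin A.width → Bool → ℝ)

lemma sum_deltaOp_add_sum_deltaIn (hN : 0 < N) :
    ∑ k, A.deltaOp level k + ∑ k, A.deltaIn level k =
      A.expect (fun u _ f => memEnergy level (A.finalMem u f)) -
        memEnergy level (zeroBits A.width) := by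
  conv_rhs => rw [← A.expect_const hN (memEnergy level (zeroBits A.width))]
  simp only [deltaOp, deltaIn]
  -- The sum telescopes along `memBefore 0, memAfter 0, memBefore 1, …, memAfter (last)`.
  rw [← expect_sum, ← expect_sum, ← expect_add, ← expect_sub]
  congr 1
  funext u b f
  rw [Finset.sum_sub_distrib, Finset.sum_sub_distrib, Fin.sum_univ_castSucc, Fin.sum_univ_succ
    fun k => memEnergy level (A.memBefore u f k)]
  change _ + memEnergy level (A.finalMem u f) - (memEnergy level (zeroBits A.width) + _) + _ = _
  ring

lemma memEnergy_memAfterOutput (u : GateSequence A.width A.queries) (f : Bits N → Bits N) :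
    memEnergy level (A.memAfterOutput u f) =
      memEnergy level (A.finalMem u f) - (level A.out (A.output u f) - level A.out false) := by
  have h : memEnergy level (A.finalMem u f) - memEnergy level (A.memAfterOutput u f) =
      level A.out (A.output u f) - level A.out false := by
    rw [memEnergy, memEnergy, ← Finset.sum_sub_distrib,
      Finset.sum_eq_single A.out (fun w _ hw => by simp [memAfterOutput, hw]) (by simp)]
    simp [memAfterOutput, output]
  linarith

lemma trace_memHam_stateBefore :
    (memHam level * A.stateBefore).trace.re =
      A.expect fun u _ f => memEnergy level (A.memAfterOutput u f) := by
  rw [← A.sum_jointProb_mul fun _ z => memEnergy level z, stateBefore, Finset.mul_sum,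
    Matrix.trace_sum, Complex.re_sum]
  refine Finset.sum_congr rfl fun a _ => ?_
  rw [memHam, subState, Matrix.diagonal_mul_diagonal, Matrix.trace_diagonal, Complex.re_sum]
  refine Finset.sum_congr rfl fun z _ => ?_
  rw [Complex.re_ofReal_mul, Complex.ofReal_re, mul_comm]

lemma trace_memHam_stateAfter (β : ℝ) (P : ErasureProtocol A.width) :
    (memHam level * A.stateAfter β P).trace.re = ∑ z, A.memProb β P z * memEnergy level z := by
  rw [memHam, Matrix.trace, Complex.re_sum]
  refine Finset.sum_congr rfl fun z _ => ?_
  rw [Matrix.diag_apply, Matrix.diagonal_mul, stateAfter_diag, Complex.re_ofReal_mul,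
    Complex.ofReal_re, memProb, mul_comm]

/-- All energy changes before the erasure cancel, up to the control costs: the agent pays for the
energy that imperfectly reset bits keep, and for the heat. -/
lemma le_energyConsumption (hN : 0 < N) (β : ℝ) (K : ControlCosts A.queries)
    (P : ErasureProtocol A.width) :
    (∑ z, A.memProb β P z * memEnergy level z) - memEnergy level (zeroBits A.width) +
      A.bathHeat β P ≤ A.energyConsumption level β K P := by
  have h1 := A.sum_deltaOp_add_sum_deltaIn level hN
  have h2 : A.deltaErasure level β P = (∑ z, A.memProb β P z * memEnergy level z) -
      A.expect fun u _ f => memEnergy level (A.memAfterOutput u f) := by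
    rw [deltaErasure, mul_sub, Matrix.trace_sub, Complex.sub_re, trace_memHam_stateBefore,
      trace_memHam_stateAfter]
  have h3 : A.expect (fun u _ f => memEnergy level (A.memAfterOutput u f)) =
      A.expect (fun u _ f => memEnergy level (A.finalMem u f)) - A.deltaOut level := by
    rw [deltaOut, ← expect_sub]
    simp only [memEnergy_memAfterOutput]
  have h4 : 0 ≤ ∑ k, (K.ops k : ℝ) := Finset.sum_nonneg fun k _ => (K.ops k).2
  have h5 : 0 ≤ ∑ k, (K.input k : ℝ) := Finset.sum_nonneg fun k _ => (K.input k).2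
  have h6 : (0 : ℝ) ≤ K.output := K.output.2
  have h7 : (0 : ℝ) ≤ K.erasure := K.erasure.2
  rw [energyConsumption, gateWork, Finset.sum_add_distrib]
  linarith

/-- Landauer's principle. The probability `η` of the reference distribution is fixed before `ε`, as
`-log η` enters with the factor `ε`, and `-log (1 - η)` without. -/
theorem exists_landauer_bound (hN : 0 < N) {β : ℝ} (hβ : 0 < β) {δ : ℝ} (hδ : 0 < δ) :
    ∃ ε : ℝ, 0 < ε ∧ ∀ (K : ControlCosts A.queries) (P : ErasureProtocol A.width),
      A.Reinitializes β ε P → 1 / β * A.condEntropy - δ ≤ A.energyConsumption level β K P := by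
  have hW : (0 : ℝ) < A.width := Nat.cast_pos.mpr A.out.pos
  -- Half of `δ` is spent on `-log (1 - η) = t` for each bit, the other half on the terms with `ε`.
  set t := β * δ / (2 * A.width) with ht
  have htpos : 0 < t := by positivity
  set η := 1 - Real.exp (-t) with hη
  have h1 : η < 1 := sub_lt_self _ (Real.exp_pos _)
  have h0 : 0 < η := sub_pos.mpr (Real.exp_lt_one_iff.mpr (neg_neg_of_pos htpos))
  have hlog1 : Real.log (1 - η) = -t := by rw [hη, sub_sub_cancel, Real.log_exp]
  have hlogη : Real.log η ≤ 0 := Real.log_nonpos h0.le h1.le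
  set D := ∑ w, |level w true - level w false| with hD
  have hD0 : 0 ≤ D := Finset.sum_nonneg fun w _ => abs_nonneg _
  set C := A.width * -Real.log η / β + D + 1 with hC
  have hCpos : 0 < C := by
    have : 0 ≤ A.width * -Real.log η / β :=
      div_nonneg (mul_nonneg hW.le (neg_nonneg.mpr hlogη)) hβ.le
    positivity
  refine ⟨δ / (2 * C), by positivity, fun K P hP => ?_⟩
  set ε := δ / (2 * C) with hε
  have hεpos : 0 < ε := by positivity
  have hfid : ∀ w, 0 ≤ 1 - A.fidelity β P w ∧ 1 - A.fidelity β P w ≤ ε := fun w =>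
    ⟨sub_nonneg.mpr (A.fidelity_le_one hN β P w), by have := hP w; linarith⟩
  have hE : -(ε * D) ≤ (∑ z, A.memProb β P z * memEnergy level z) -
      memEnergy level (zeroBits A.width) := by
    simp only [memEnergy_eq level]
    rw [A.sum_memProb_mul hN, ← Finset.sum_sub_distrib, hD, Finset.mul_sum,
      ← Finset.sum_neg_distrib]
    refine Finset.sum_le_sum fun w _ => ?_
    have habs := neg_abs_le (level w true - level w false)
    have hmul := mul_le_mul_of_nonneg_right (hfid w).2 (abs_nonneg (level w true - level w false))
    have hmul' := mul_le_mul_of_nonneg_left habs (hfid w).1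
    simp only [zeroBits, if_true]
    linarith
  have hS : -(A.width * t) - ε * (A.width * -Real.log η) ≤
      ∑ z, A.memProb β P z * Real.log (bernoulliProd η z) := by
    simp only [log_bernoulliProd h0 h1]
    rw [A.sum_memProb_mul hN, hlog1]
    have hw : ∀ w ∈ Finset.univ, -t - ε * -Real.log η ≤
        Real.log η + A.fidelity β P w * (-t - Real.log η) := by
      intro w _
      have hmul := mul_le_mul_of_nonneg_right (hfid w).2 (neg_nonneg.mpr hlogη)
      have hmul' := mul_nonneg (hfid w).1 htpos.le
      linarith
    have := Finset.sum_le_sum hw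
    rw [Finset.sum_const, Finset.card_univ, Fintype.card_fin, nsmul_eq_mul] at this
    linarith
  have hQ := A.condEntropy_add_le_bathHeat hN β P h0 h1
  have hbal := A.le_energyConsumption level hN β K P
  have hdiv : 1 / β * A.condEntropy - (A.width * t / β + ε * (A.width * -Real.log η / β)) ≤
      A.bathHeat β P := by
    rw [← mul_le_mul_iff_right₀ hβ]
    have e : β * (1 / β * A.condEntropy -
        (A.width * t / β + ε * (A.width * -Real.log η / β))) =
          A.condEntropy - A.width * t - ε * (A.width * -Real.log η) := by
      field_simp
      ring
    linarith
  have ht2 : A.width * t / β = δ / 2 := by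
    rw [ht]; field_simp
  have hεC : ε * C = δ / 2 := by
    rw [hε]; field_simp
  have : ε * C = ε * (A.width * -Real.log η / β) + ε * D + ε := by rw [hC]; ring
  linarith

end ClassicalAlgorithm

/-! ### The explicit bound -/

/-- `n! / (n - k)! ≥ (n / e) ^ k`. In the inductive step, `k (log (n + 1) - log n) ≤ k / n ≤ 1`. -/
lemma mul_log_sub_one_le_log_factorial_div (n k : ℕ) (hk : k ≤ n) :
    k * (Real.log n - 1) ≤ Real.log (n.factorial / (n - k).factorial) := by
  induction n generalizing k with
  | zero =>
    obtain rfl : k = 0 := by omega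
    simp
  | succ n ih =>
    cases k with
    | zero =>
      rw [Nat.sub_zero, div_self (Nat.cast_ne_zero.mpr (Nat.factorial_ne_zero _))]
      simp
    | succ k =>
      have hkn : k ≤ n := by omega
      have hdiv : ((n + 1).factorial / (n + 1 - (k + 1)).factorial : ℝ) =
          ((n + 1 : ℕ) : ℝ) * (n.factorial / (n - k).factorial) := by
        rw [Nat.factorial_succ, Nat.add_sub_add_right, Nat.cast_mul, mul_div_assoc]
      rw [hdiv, Real.log_mul (by positivity) (by positivity)]
      have h := ih k hkn
      have hstep : k * (Real.log ((n + 1 : ℕ) : ℝ) - Real.log n) ≤ 1 := by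
        rcases Nat.eq_zero_or_pos n with rfl | hn
        · obtain rfl : k = 0 := by omega
          simp
        · have hn' : (0 : ℝ) < n := Nat.cast_pos.mpr hn
          have hlog := Real.log_le_sub_one_of_pos (x := ((n + 1 : ℕ) : ℝ) / n) (by positivity)
          rw [Real.log_div (by positivity) hn'.ne'] at hlog
          have e : ((n + 1 : ℕ) : ℝ) / n - 1 = 1 / n := by
            push_cast
            field_simp
            ring
          calc k * (Real.log ((n + 1 : ℕ) : ℝ) - Real.log n) ≤ k * (1 / n) := by
                rw [e] at hlog
                gcongr
            _ ≤ n * (1 / n) := by gcongr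
            _ = 1 := by field_simp
      rw [Nat.cast_succ k]
      linarith

lemma two_rpow_half_sq (N : ℕ) : ((2 : ℝ) ^ ((N : ℝ) / 2)) ^ 2 = 2 ^ N := by
  rw [← Real.rpow_natCast, ← Real.rpow_mul zero_le_two, ← Real.rpow_natCast]
  congr 1
  push_cast
  ring

/-- The number of points is chosen such that a collision among them has probability at most
`Δ / (1 + Δ)`. -/
lemma ClassicalAlgorithm.SolvesSimon.entropyBound_le {N : ℕ} {A : ClassicalAlgorithm N}
    (hA : A.SolvesSimon) (hN : 0 < N) {Δ : ℝ} (hΔ : Δ ∈ Set.Ioo (0 : ℝ) (1 / 6)) :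
    entropyBound N Δ ≤ A.condEntropy := by
  obtain ⟨h0, h1⟩ := hΔ
  have hlog2 : 0 < Real.log 2 := Real.log_pos one_lt_two
  have hF : 0 ≤ (1 - 6 * Δ) / (6 - 12 * Δ) := div_nonneg (by linarith) (by linarith)
  rw [entropyBound]
  set x := √(2 * Δ / (1 + Δ)) * (2 : ℝ) ^ ((N : ℝ) / 2) with hx
  set F := (1 - 6 * Δ) / (6 - 12 * Δ) with hFdef
  have hx0 : 0 < x := by positivity
  -- The bound is negative for `N = 1`.
  rcases le_total (N * Real.log 2 - 1) 0 with hneg | hpos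
  · have h2 : x * (N * Real.log 2 - 1) ≤ 0 := mul_nonpos_of_nonneg_of_nonpos hx0.le hneg
    have h3 : F * (x * (N * Real.log 2 - 1) - 1) ≤ 0 :=
      mul_nonpos_of_nonneg_of_nonpos hF (by linarith)
    linarith [A.condEntropy_nonneg]
  have hn : (1 : ℝ) < 2 ^ N := one_lt_pow₀ one_lt_two hN.ne'
  have hxsq : x ^ 2 = 2 * Δ / (1 + Δ) * 2 ^ N := by
    rw [hx, mul_pow, Real.sq_sqrt (by positivity), two_rpow_half_sq]
  have hratio : 2 * Δ / (1 + Δ) ≤ 1 := by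
    rw [div_le_one (by linarith)]
    linarith
  have hxn : x ≤ 2 ^ N := by
    refine le_of_sq_le_sq ?_ (by positivity)
    rw [hxsq]
    nlinarith
  obtain ⟨m, hm⟩ : ∃ m, ⌈x⌉₊ = m + 1 :=
    ⟨⌈x⌉₊ - 1, (Nat.sub_add_cancel (Nat.ceil_pos.mpr hx0)).symm⟩
  have hmx : (m : ℝ) ≤ x := by
    have := Nat.ceil_lt_add_one hx0.le
    rw [hm] at this
    push_cast at this
    linarith
  have hxm : x ≤ m + 1 := by
    have := Nat.le_ceil x
    rw [hm] at this
    exact_mod_cast this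
  have hmn : m + 1 ≤ 2 ^ N := by
    rw [← hm]
    exact Nat.ceil_le.mpr (by exact_mod_cast hxn)
  have hδ : (m : ℝ) * (m - 1) / 2 / ((2 : ℝ) ^ N - 1) ≤ Δ / (1 + Δ) := by
    have hm0 : (0 : ℝ) ≤ m := Nat.cast_nonneg m
    have hmn' : (m : ℝ) ≤ 2 ^ N := hmx.trans hxn
    have hmsq : (m : ℝ) ^ 2 ≤ 2 * (Δ / (1 + Δ)) * 2 ^ N := by
      rw [← mul_div_assoc, ← hxsq]
      gcongr
    have h2 : (m : ℝ) * (m - 1) * 2 ^ N ≤ m ^ 2 * (2 ^ N - 1) := by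
      nlinarith [mul_nonneg hm0 (sub_nonneg.mpr hmn')]
    have h3 : (m : ℝ) ^ 2 * (2 ^ N - 1) ≤ 2 * (Δ / (1 + Δ)) * 2 ^ N * (2 ^ N - 1) :=
      mul_le_mul_of_nonneg_right hmsq (by linarith)
    rw [div_div, div_le_iff₀ (by linarith)]
    refine le_of_mul_le_mul_right ?_ (show (0 : ℝ) < 2 ^ N by linarith)
    linarith
  have hcoef : F ≤ 1 / 2 * (1 / 3 - Δ / (1 + Δ)) := by
    have e : 1 / 2 * (1 / 3 - Δ / (1 + Δ)) = (1 - 2 * Δ) / (6 * (1 + Δ)) := by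
      field_simp
      ring
    rw [e, hFdef, div_le_div_iff₀ (by linarith) (by linarith)]
    nlinarith
  have hfac := mul_log_sub_one_le_log_factorial_div (2 ^ N) (m + 1) hmn
  rw [Nat.cast_pow, Nat.cast_ofNat, Real.log_pow, Nat.cast_succ] at hfac
  refine le_trans ?_ (hA.entropy_ge hN m)
  refine sub_le_sub_right ?_ _
  calc F * (x * (N * Real.log 2 - 1) - 1) ≤ F * (x * (N * Real.log 2 - 1)) := by
        gcongr
        linarith
    _ ≤ F * ((m + 1) * (N * Real.log 2 - 1)) := by gcongr
    _ ≤ F * Real.log ((2 ^ N).factorial / (2 ^ N - (m + 1)).factorial) := by gcongr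
    _ ≤ _ := by
        refine mul_le_mul_of_nonneg_right (by linarith) (Real.log_nonneg ?_)
        refine (one_le_div (by positivity)).mpr ?_
        exact_mod_cast Nat.factorial_le (Nat.sub_le _ _)

lemma sqrt_fifteen_bounds : 3.87 < √15 ∧ √15 < 3.88 :=
  ⟨Real.lt_sqrt_of_sq_lt (by norm_num), (Real.sqrt_lt' (by norm_num)).mpr (by norm_num)⟩

lemma optimal_mem_Ioo : 2 - √15 / 2 ∈ Set.Ioo (0 : ℝ) (1 / 6) := by
  obtain ⟨h1, h2⟩ := sqrt_fifteen_bounds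
  constructor <;> linarith

lemma leadingFactor_sq {Δ : ℝ} (hΔ : Δ ∈ Set.Ioo (0 : ℝ) (1 / 6)) :
    leadingFactor Δ ^ 2 = (1 - 6 * Δ) ^ 2 * Δ / ((1 - 2 * Δ) ^ 2 * (1 + Δ)) / 18 := by
  obtain ⟨h0, h1⟩ := hΔ
  have h2 : (1 - 2 * Δ) ≠ 0 := by linarith
  have h3 : 1 + Δ ≠ 0 := by linarith
  rw [leadingFactor, mul_pow, Real.sq_sqrt (div_nonneg (by linarith) (by linarith)),
    show 6 - 12 * Δ = 6 * (1 - 2 * Δ) by ring]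
  field_simp
  ring

/-- The difference between `(39 - 10 √15) / 9`, the maximum of
`(1 - 6Δ)² Δ / ((1 - 2Δ)² (1 + Δ))`, and this function has a double zero at the optimal point. -/
lemma optimal_identity (Δ : ℝ) :
    (39 - 10 * √15) / 9 * ((1 - 2 * Δ) ^ 2 * (1 + Δ)) - (1 - 6 * Δ) ^ 2 * Δ =
      (Δ - (2 - √15 / 2)) ^ 2 * ((4 * ((39 - 10 * √15) / 9) - 36) * Δ + 4 + 8 * √15 / 9) := by
  have hs : √15 ^ 2 = 15 := Real.sq_sqrt (by norm_num)
  linear_combination ((40 * Δ ^ 2 + (10 * √15 - 46) * Δ + 7 - 2 * √15) / 9) * hs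

lemma leadingFactor_le_optimal {Δ : ℝ} (hΔ : Δ ∈ Set.Ioo (0 : ℝ) (1 / 6)) :
    leadingFactor Δ ≤ leadingFactor (2 - √15 / 2) := by
  obtain ⟨s1, s2⟩ := sqrt_fifteen_bounds
  have hden : ∀ Δ ∈ Set.Ioo (0 : ℝ) (1 / 6), 0 < (1 - 2 * Δ) ^ 2 * (1 + Δ) := fun Δ h =>
    mul_pos (pow_pos (by linarith [h.2]) 2) (by linarith [h.1])
  have hopt : (1 - 6 * (2 - √15 / 2)) ^ 2 * (2 - √15 / 2) /
      ((1 - 2 * (2 - √15 / 2)) ^ 2 * (1 + (2 - √15 / 2))) = (39 - 10 * √15) / 9 := by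
    rw [div_eq_iff (hden _ optimal_mem_Ioo).ne']
    have h := optimal_identity (2 - √15 / 2)
    rw [sub_self, zero_pow two_ne_zero, zero_mul] at h
    linarith
  have hnonneg : 0 ≤ leadingFactor (2 - √15 / 2) :=
    mul_nonneg (div_nonneg (by linarith) (by linarith)) (Real.sqrt_nonneg _)
  refine le_of_sq_le_sq ?_ hnonneg
  rw [leadingFactor_sq hΔ, leadingFactor_sq optimal_mem_Ioo, hopt]
  refine div_le_div_of_nonneg_right ?_ (by norm_num)
  rw [div_le_iff₀ (hden Δ hΔ), ← sub_nonneg, optimal_identity]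
  refine mul_nonneg (sq_nonneg _) ?_
  obtain ⟨h0, h1⟩ := hΔ
  have h2 : (36 - 4 * ((39 - 10 * √15) / 9)) * Δ ≤ (36 - 4 * ((39 - 10 * √15) / 9)) * (1 / 6) :=
    mul_le_mul_of_nonneg_left h1.le (by linarith)
  linarith

lemma entropyBound_optimal (N : ℕ) :
    (3 * √15 - 11) / (6 * √15 - 18) *
      (√((8 - 2 * √15) / (6 - √15)) * (2 : ℝ) ^ ((N : ℝ) / 2) * (N * Real.log 2 - 1) - 1)
      - Real.log 2 = entropyBound N (2 - √15 / 2) := by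
  obtain ⟨s1, s2⟩ := sqrt_fifteen_bounds
  have h1 : (1 - 6 * (2 - √15 / 2)) / (6 - 12 * (2 - √15 / 2)) =
      (3 * √15 - 11) / (6 * √15 - 18) := by
    congr 1 <;> ring
  have h2 : 2 * (2 - √15 / 2) / (1 + (2 - √15 / 2)) = (8 - 2 * √15) / (6 - √15) := by
    rw [div_eq_div_iff (by linarith) (by linarith)]
    ring
  rw [entropyBound, h1, h2]

/-! ### Asymptotics -/

/-- The bound with `Δ = 1/12`. -/
lemma ClassicalAlgorithm.SolvesSimon.mul_two_rpow_le {N : ℕ} {A : ClassicalAlgorithm N}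
    (hA : A.SolvesSimon) (hN : 8 ≤ N) :
    1 / 120 * (N * (2 : ℝ) ^ ((N : ℝ) / 2)) ≤ A.condEntropy := by
  have h := hA.entropyBound_le (by omega) (Δ := 1 / 12) ⟨by norm_num, by norm_num⟩
  refine le_trans ?_ h
  rw [entropyBound]
  have hN' : (8 : ℝ) ≤ N := by exact_mod_cast hN
  have hsqrt : (1 / 3 : ℝ) ≤ √(2 * (1 / 12) / (1 + 1 / 12)) :=
    Real.le_sqrt_of_sq_le (by norm_num)
  set y := (2 : ℝ) ^ ((N : ℝ) / 2) with hy
  have hy16 : 16 ≤ y := by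
    calc (16 : ℝ) = 2 ^ (4 : ℝ) := by norm_num
      _ ≤ y := Real.rpow_le_rpow_of_exponent_le one_le_two (by linarith)
  have hlog1 := Real.log_two_gt_d9
  have hlog2 := Real.log_two_lt_d9
  have hL : (N : ℝ) / 2 ≤ N * Real.log 2 - 1 := by nlinarith
  have hmain : 1 / 3 * y * (N / 2) ≤
      √(2 * (1 / 12) / (1 + 1 / 12)) * y * (N * Real.log 2 - 1) := by gcongr
  have hNy : 128 ≤ N * y := by nlinarith
  have hcoef : ((1 : ℝ) - 6 * (1 / 12)) / (6 - 12 * (1 / 12)) = 1 / 10 := by norm_num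
  rw [hcoef]
  linarith

/-- With `y = 2 ^ (N / 4)` the left side is at most `N y`, and the right side grows like `N y²`. -/
lemma exists_exp_le (β : ℝ) (hβ : 0 < β) : ∃ N₀ : ℕ, ∀ N ≥ N₀, 8 ≤ N ∧
    Real.exp (Real.log 2 / 4 * (N + Real.log N)) ≤
      1 / β * (1 / 120 * (N * (2 : ℝ) ^ ((N : ℝ) / 2))) - 1 := by
  refine ⟨max 8 ⌈1920 * β⌉₊, fun N hN => ?_⟩
  have hN8 : 8 ≤ N := le_trans (le_max_left _ _) hN
  have hNβ : 1920 * β ≤ N := (Nat.le_ceil _).trans (by exact_mod_cast (le_max_right _ _).trans hN)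
  refine ⟨hN8, ?_⟩
  have hN' : (8 : ℝ) ≤ N := by exact_mod_cast hN8
  have hlog1 := Real.log_two_gt_d9
  have hlog2 := Real.log_two_lt_d9
  set y := Real.exp (Real.log 2 / 4 * N) with hy
  have hysq : (2 : ℝ) ^ ((N : ℝ) / 2) = y ^ 2 := by
    rw [hy, ← Real.exp_nat_mul, Real.rpow_def_of_pos two_pos]
    congr 1
    push_cast
    ring
  have hyN : N / 8 ≤ y := by
    have := Real.add_one_le_exp (Real.log 2 / 4 * N)
    nlinarith
  have hypos : 0 < y := Real.exp_pos _
  have hexp : Real.exp (Real.log 2 / 4 * (N + Real.log N)) ≤ N * y := by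
    rw [mul_add, Real.exp_add, mul_comm]
    gcongr
    calc Real.exp (Real.log 2 / 4 * Real.log N) ≤ Real.exp (Real.log N) := by
          refine Real.exp_le_exp.mpr (mul_le_of_le_one_left (Real.log_nonneg (by linarith)) ?_)
          linarith
      _ = N := Real.exp_log (by linarith)
  have hone : 1 ≤ N * y := by nlinarith
  have hratio : 2 ≤ y / (120 * β) := by
    rw [le_div_iff₀ (by positivity)]
    linarith
  have e : 1 / β * (1 / 120 * (N * y ^ 2)) = N * y * (y / (120 * β)) := by
    field_simp
  rw [hysq, e]
  nlinarith [mul_le_mul_of_nonneg_left hratio (zero_le_one.trans hone)]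

end SimonThermo

end

theorem corollary2 :
    (∀ (N : ℕ), 0 < N → ∀ A : ClassicalAlgorithm N, A.SolvesSimon →
      (∀ (β : ℝ), 0 < β → ∀ (level : Fin A.width → Bool → ℝ) (δ : ℝ), 0 < δ →
        ∃ ε : ℝ, 0 < ε ∧ ∀ (K : ControlCosts A.queries) (P : ErasureProtocol A.width),
          A.Reinitializes β ε P →
            1 / β * A.condEntropy - δ ≤ A.energyConsumption level β K P) ∧
      (∀ Δ ∈ Set.Ioo (0 : ℝ) (1 / 6), entropyBound N Δ ≤ A.condEntropy) ∧
      (3 * √15 - 11) / (6 * √15 - 18) *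
          (√((8 - 2 * √15) / (6 - √15)) * (2 : ℝ) ^ ((N : ℝ) / 2) * (N * Real.log 2 - 1) - 1)
          - Real.log 2 ≤ A.condEntropy) ∧
    (2 - √15 / 2 ∈ Set.Ioo (0 : ℝ) (1 / 6) ∧
      ∀ Δ ∈ Set.Ioo (0 : ℝ) (1 / 6), leadingFactor Δ ≤ leadingFactor (2 - √15 / 2)) ∧
    (∃ c : ℝ, 0 < c ∧ ∃ N₀ : ℕ, ∀ N ≥ N₀, ∀ A : ClassicalAlgorithm N, A.SolvesSimon →
      c * (N * (2 : ℝ) ^ ((N : ℝ) / 2)) ≤ A.condEntropy) ∧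
    (∀ β : ℝ, 0 < β → ∃ c : ℝ, 0 < c ∧ ∃ N₀ : ℕ, ∀ N ≥ N₀,
      ∀ A : ClassicalAlgorithm N, A.SolvesSimon → ∀ level : Fin A.width → Bool → ℝ,
        ∃ ε : ℝ, 0 < ε ∧ ∀ (K : ControlCosts A.queries) (P : ErasureProtocol A.width),
          A.Reinitializes β ε P →
            Real.exp (c * (N + Real.log N)) ≤ A.energyConsumption level β K P) := by
  refine ⟨fun N hN A hA => ⟨fun β hβ level δ hδ => A.exists_landauer_bound level hN hβ hδ,
    fun Δ hΔ => hA.entropyBound_le hN hΔ, ?_⟩, ⟨optimal_mem_Ioo, fun Δ hΔ =>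
      leadingFactor_le_optimal hΔ⟩, ⟨1 / 120, by norm_num, 8, fun N hN A hA =>
        hA.mul_two_rpow_le hN⟩, fun β hβ => ?_⟩
  · rw [entropyBound_optimal]
    exact hA.entropyBound_le hN optimal_mem_Ioo
  · obtain ⟨N₀, hN₀⟩ := exists_exp_le β hβ
    refine ⟨Real.log 2 / 4, div_pos (Real.log_pos one_lt_two) (by norm_num), N₀,
      fun N hN A hA level => ?_⟩
    obtain ⟨hN8, hexp⟩ := hN₀ N hN
    obtain ⟨ε, hε, hW⟩ := A.exists_landauer_bound level (by omega) hβ one_pos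
    refine ⟨ε, hε, fun K P hP => hexp.trans (le_trans ?_ (hW K P hP))⟩
    have hS := mul_le_mul_of_nonneg_left (hA.mul_two_rpow_le hN8) (one_div_pos.mpr hβ).le
    linarith
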